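/- Let $0<l<\infty$ and let $q\in L^2(0,l)$ be real-valued. For $\lambda\in\mathbb{C}$ let $s_p(\lambda,x)$ ($p=0,1,2$, $x\in[0,l]$) be the fundamental solutions of $iy'''(x)+q(x)y(x)=\lambda^3y(x)$ with initial data $s_p^{(k)}(\lambda,0)=\delta_{kp}$ ($0\le k,p\le2$); explicitly, $s_p(\lambda,\cdot)=\sum_{n\ge0}i^nK_\lambda^n e_p(\lambda,\cdot)$, where $e_p(\lambda,x)=\frac{1}{3(i\lambda)^p}\sum_{\zeta^3=1}\zeta^{-p}e^{i\lambda\zeta x}$ (and $e_p(0,x)=x^p/p!$) and $(K_\lambda f)(x)=\int_0^x e_2(\lambda,x-t)\,q(t)f(t)\,dt$. For $\theta\in\mathbb{C}$ with $|\theta|=1$ let $$\Delta_\theta(q,\lambda)=s_2(\lambda,l)s_1'(\lambda,l)-s_1(\lambda,l)s_2'(\lambda,l)-\theta s_2(\lambda,l)$$ be the characteristic function of the operator $iy'''+qy$ in $L^2(0,l)$ with boundary conditions $y(0)=0$, $y'(l)=\theta y'(0)$, $y(l)=0$. Then $a:=s_2(0,l)\neq0$ (a number that depends only on $q$ and $l$,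 not on $\theta$), and $\theta_0:=\overline{a}/a$ satisfies $|\theta_0|=1$. If $|\theta|=1$ and $\theta+\theta_0\neq0$, then the real zeros of $\Delta_\theta(q,\cdot)$ can be enumerated in ascending order as $\dots<\lambda_{-1}(q,\theta)<\lambda_0(q,\theta)<\lambda_1(q,\theta)<\dots$ (indexed by $\mathbb{Z}$, each real zero listed exactly once, $\lambda_0(q,\theta)$ being the smallest non-negative one), and for every $\lambda\in\mathbb{C}$ $$\Delta_\theta(q,\lambda)=-a(\theta+\theta_0)\prod_{n\in\mathbb{Z}}\left(1-\frac{\lambda^3}{\lambda_n^3(q,\theta)}\right),$$ where the product converges unconditionally. -/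

import Mathlib

noncomputable section

namespace ThirdOrder

open MeasureTheory Complex

/-- The three cube roots of unity `1`, `(-1 + i√3)/2`, `(-1 - i√3)/2`. -/
def zeta : Fin 3 → ℂ :=
  ![1, (-1 + I * (Real.sqrt 3 : ℂ)) / 2, (-1 - I * (Real.sqrt 3 : ℂ)) / 2]

/-- `s_p(z) = (1/3) ∑_k ζ_k^{-p} e^{z ζ_k}`, the analogues of cosine and sine for `y''' = y`. -/
def sFun (p : Fin 3) (z : ℂ) : ℂ :=
  (1 / 3) * ∑ k : Fin 3, (1 / zeta k ^ (p : ℕ)) * exp (z * zeta k)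

/-- The function `s_p(iλx)/(iλ)^p`, entire in `λ`; at `λ = 0` it is understood as its limit
`x^p / p!`. It solves `i y''' = λ³ y`, with the `p`-th initial derivative `1` and the two other
initial data `0`. -/
def freeSol (p : Fin 3) (lam : ℂ) (x : ℝ) : ℂ :=
  if lam = 0 then (x : ℂ) ^ (p : ℕ) / ((p : ℕ).factorial : ℂ)
  else sFun p (I * lam * x) / (I * lam) ^ (p : ℕ)

/-- The Volterra operator `K_λ`, `(K_λ f)(x) = ∫_0^x K₁(λ,x,t) q(t) f(t) dt`, with the kernel
`K₁(λ,x,t) = s_2(iλ(x-t))/(iλ)²`. -/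
def volterra (q : ℝ → ℝ) (lam : ℂ) (f : ℝ → ℂ) (x : ℝ) : ℂ :=
  ∫ t in (0 : ℝ)..x, freeSol 2 lam (x - t) * (q t : ℂ) * f t

/-- The fundamental solutions `s_p(λ,x)` of `i y''' + q y = λ³ y`, with initial data
`s_p^{(k)}(λ,0) = δ_{kp}` (`0 ≤ k, p ≤ 2`): the image of `s_p(iλx)/(iλ)^p` under the
transformation operator `(I - iK_λ)⁻¹ = ∑_{n ≥ 0} iⁿ K_λⁿ`. -/
def fundSol (q : ℝ → ℝ) (p : Fin 3) (lam : ℂ) (x : ℝ) : ℂ :=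
  ∑' n : ℕ, I ^ n * (volterra q lam)^[n] (freeSol p lam) x

/-- `s_p'(λ,l)`, the derivative in `x` at the right end of the interval `[0,l]`. -/
def fundSolDerivEnd (q : ℝ → ℝ) (l : ℝ) (p : Fin 3) (lam : ℂ) : ℂ :=
  derivWithin (fundSol q p lam) (Set.Icc 0 l) l

/-- The characteristic function
`Δ_θ(q,λ) = s_2(λ,l) s_1'(λ,l) - s_1(λ,l) s_2'(λ,l) - θ s_2(λ,l)`, the determinant of the
boundary conditions `y'(l) = θ y'(0)`, `y(l) = 0` on the solutions `y₁ s_1 + y₂ s_2`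
(those with `y(0) = 0`). -/
def charFun (q : ℝ → ℝ) (l : ℝ) (θ lam : ℂ) : ℂ :=
  fundSol q 2 lam l * fundSolDerivEnd q l 1 lam
    - fundSol q 1 lam l * fundSolDerivEnd q l 2 lam
    - θ * fundSol q 2 lam l

/-- `a = s_2(0,l)`. -/
def aConst (q : ℝ → ℝ) (l : ℝ) : ℂ := fundSol q 2 0 l

/-- `θ₀ = ā / a`. -/
def theta0 (q : ℝ → ℝ) (l : ℝ) : ℂ := (starRingEnd ℂ) (aConst q l) / aConst q l

/-- The set of real zeros of `Δ_θ(q,·)`. -/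
def realZeros (q : ℝ → ℝ) (l : ℝ) (θ : ℂ) : Set ℝ := {x : ℝ | charFun q l θ (x : ℂ) = 0}

/-- `… < μ_{-1} < μ_0 < μ_1 < …` enumerates exactly the elements of `S`, and `μ_0` is the
smallest non-negative element of `S`. -/
structure IsAscendingEnumeration (S : Set ℝ) (μ : ℤ → ℝ) : Prop where
  strictMono : StrictMono μ
  range_eq : Set.range μ = S
  isLeast_zero : IsLeast {x | x ∈ S ∧ 0 ≤ x} (μ 0)

end ThirdOrder

end

/-
In the variable `z = λ³` put `s(z) = s₂(λ, l)`. If `u` solves `i u''' + q u = z u` with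
`u(0) = u'(0) = 0`, then `(|u|²)'' = 3|u'|² + 2 Im z ∫₀ˣ |u|²` by Lagrange's identity, so `|u|²` is
convex when `Im z ≥ 0`, and `s` has no zeros in the closed upper half-plane. The same identity gives
`s₂ s₁' - s₁ s₂' = -conj s(conj z)`, so that `Δ_θ = -conj s(conj z) - θ s(z)` is a function of `z`,
and that its zeros in `z` are real and simple. As an entire function of `z` it has order at most
`1/3`, so its Hadamard factorization has no exponential factor. If its zeros were bounded above,
comparing the factors `1 - z/a` at `z = iy` and `z = y` would keep the quotient
`|Δ_θ(iy)| / |Δ_θ(y)|` bounded as `y → ∞`, whereas it grows exponentially in `y^{1/3}`; the zeros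
are likewise unbounded below.
-/

noncomputable section

namespace ThirdOrder

open MeasureTheory Complex

theorem intervalIntegrable_of_mem_Icc {E : Type*} [NormedAddCommGroup E] {f : ℝ → E} {l x : ℝ}
    (hf : IntervalIntegrable f volume 0 l) (hx : x ∈ Set.Icc 0 l) :
    IntervalIntegrable f volume 0 x :=
  hf.mono_set (Set.uIcc_subset_uIcc_left (Set.Icc_subset_uIcc hx))

theorem integral_triangle_swap {E : Type*} [NormedAddCommGroup E] [NormedSpace ℝ E]
    {F : ℝ → ℝ → E} {x : ℝ} (hx : 0 ≤ x)
    (hF : Integrable (Function.uncurry F)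
      ((volume.restrict (Set.Ioc 0 x)).prod (volume.restrict (Set.Ioc 0 x)))) :
    IntervalIntegrable (fun s => ∫ t in (0 : ℝ)..s, F s t) volume 0 x ∧
    ∫ s in (0 : ℝ)..x, ∫ t in (0 : ℝ)..s, F s t = ∫ t in (0 : ℝ)..x, ∫ s in t..x, F s t := by
  set T : Set (ℝ × ℝ) := {p | p.2 ≤ p.1}
  have hG := hF.indicator (measurableSet_le measurable_snd measurable_fst : MeasurableSet T)
  have hrow : ∀ s ∈ Set.Ioc 0 x, ∫ t in (0 : ℝ)..s, F s t
      = ∫ t in Set.Ioc 0 x, T.indicator (Function.uncurry F) (s, t) := by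
    intro s hs
    have : (fun t => T.indicator (Function.uncurry F) (s, t)) = (Set.Iic s).indicator (F s) := rfl
    rw [this, setIntegral_indicator measurableSet_Iic, Set.Ioc_inter_Iic, min_eq_right hs.2,
      intervalIntegral.integral_of_le hs.1.le]
  have hcol : ∀ t ∈ Set.Ioc 0 x, ∫ s in t..x, F s t
      = ∫ s in Set.Ioc 0 x, T.indicator (Function.uncurry F) (s, t) := by
    intro t ht
    have hinter : Set.Ioc 0 x ∩ Set.Ici t = Set.Icc t x := by
      ext s
      exact ⟨fun h => ⟨h.2, h.1.2⟩, fun h => ⟨⟨ht.1.trans_le h.1, h.2⟩, h.1⟩⟩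
    have : (fun s => T.indicator (Function.uncurry F) (s, t))
        = (Set.Ici t).indicator (fun s => F s t) := rfl
    rw [this, setIntegral_indicator measurableSet_Ici, hinter, integral_Icc_eq_integral_Ioc,
      intervalIntegral.integral_of_le ht.2]
  constructor
  · rw [intervalIntegrable_iff_integrableOn_Ioc_of_le hx]
    exact (integrableOn_congr_fun hrow measurableSet_Ioc).2 hG.integral_prod_left
  · rw [intervalIntegral.integral_of_le hx, intervalIntegral.integral_of_le hx,
      setIntegral_congr_fun measurableSet_Ioc hrow, setIntegral_congr_fun measurableSet_Ioc hcol]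
    exact integral_integral_swap hG

theorem integral_mul_integral_add {𝕜 : Type*} [RCLike 𝕜] {a b : ℝ → 𝕜} {x : ℝ} (hx : 0 ≤ x)
    (ha : IntervalIntegrable a volume 0 x) (hb : IntervalIntegrable b volume 0 x) :
    (∫ s in (0 : ℝ)..x, b s * ∫ t in (0 : ℝ)..s, a t)
      + ∫ t in (0 : ℝ)..x, a t * ∫ s in (0 : ℝ)..t, b s
      = (∫ t in (0 : ℝ)..x, a t) * ∫ s in (0 : ℝ)..x, b s := by
  have hswap := (integral_triangle_swap (F := fun s t => b s * a t) hx
    (Integrable.mul_prod ((intervalIntegrable_iff_integrableOn_Ioc_of_le hx).1 hb)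
      ((intervalIntegrable_iff_integrableOn_Ioc_of_le hx).1 ha))).2
  simp only [intervalIntegral.integral_const_mul, intervalIntegral.integral_mul_const] at hswap
  have h_int : IntervalIntegrable (fun t => a t * ∫ s in (0 : ℝ)..t, b s) volume 0 x :=
    ha.mul_continuousOn (intervalIntegral.continuousOn_primitive_interval' hb Set.left_mem_uIcc)
  have htail : ∀ t ∈ Set.uIcc 0 x, (∫ s in t..x, b s) * a t
      = a t * (∫ s in (0 : ℝ)..x, b s) - a t * ∫ s in (0 : ℝ)..t, b s := by
    intro t ht
    rw [Set.uIcc_of_le hx] at ht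
    have hbt := intervalIntegrable_of_mem_Icc hb ht
    rw [← intervalIntegral.integral_add_adjacent_intervals hbt (hbt.symm.trans hb)]
    ring
  rw [hswap, intervalIntegral.integral_congr htail,
    intervalIntegral.integral_sub (ha.mul_const _) h_int, intervalIntegral.integral_mul_const]
  ring

/-- `f` is, on `[0, l]`, an indefinite integral of the integrable function `f'`. This is absolute
continuity with almost everywhere derivative `f'`, but with a chosen representative of `f'`. -/
structure IsPrimitive {𝕜 : Type*} [RCLike 𝕜] (l : ℝ) (f f' : ℝ → 𝕜) : Prop where
  intervalIntegrable : IntervalIntegrable f' volume 0 l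
  eq_add_integral : ∀ x ∈ Set.Icc 0 l, f x = f 0 + ∫ t in (0 : ℝ)..x, f' t

namespace IsPrimitive

variable {𝕜 : Type*} [RCLike 𝕜] {l x : ℝ} {f f' g g' : ℝ → 𝕜}

theorem mono (h : IsPrimitive l f f') (hx : x ∈ Set.Icc 0 l) : IsPrimitive x f f' :=
  ⟨intervalIntegrable_of_mem_Icc h.intervalIntegrable hx,
    fun y hy => h.eq_add_integral y ⟨hy.1, hy.2.trans hx.2⟩⟩

theorem congr_deriv (h : IsPrimitive l f f') (hl : 0 ≤ l)
    (hg : ∀ x ∈ Set.Icc 0 l, f' x = g' x) : IsPrimitive l f g' := by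
  refine ⟨h.intervalIntegrable.congr fun t ht => hg t ?_, fun x hx => ?_⟩
  · rw [Set.uIoc_of_le hl] at ht
    exact Set.Ioc_subset_Icc_self ht
  · rw [h.eq_add_integral x hx, intervalIntegral.integral_congr fun t ht => hg t ?_]
    rw [Set.uIcc_of_le hx.1] at ht
    exact ⟨ht.1, ht.2.trans hx.2⟩

theorem congr_fun (h : IsPrimitive l f f') (hl : 0 ≤ l) (hg : ∀ x ∈ Set.Icc 0 l, f x = g x) :
    IsPrimitive l g f' :=
  ⟨h.intervalIntegrable, fun x hx => by
    rw [← hg x hx, ← hg 0 ⟨le_rfl, hl⟩, h.eq_add_integral x hx]⟩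

theorem continuousOn (h : IsPrimitive l f f') (hl : 0 ≤ l) : ContinuousOn f (Set.Icc 0 l) := by
  have h_int := intervalIntegral.continuousOn_primitive_interval' h.intervalIntegrable
    Set.left_mem_uIcc
  rw [Set.uIcc_of_le hl] at h_int
  exact (continuousOn_const.add h_int).congr h.eq_add_integral

theorem hasDerivWithinAt (h : IsPrimitive l f f') (hc : ContinuousOn f' (Set.Icc 0 l))
    (hx : x ∈ Set.Icc 0 l) : HasDerivWithinAt f (f' x) (Set.Icc 0 l) x := by
  have : Fact (x ∈ Set.Icc 0 l) := ⟨hx⟩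
  have h_int : HasDerivWithinAt (fun u => ∫ t in (0 : ℝ)..u, f' t) (f' x) (Set.Icc 0 l) x :=
    intervalIntegral.integral_hasDerivWithinAt_right
      (intervalIntegrable_of_mem_Icc h.intervalIntegrable hx) (t := Set.Icc 0 l)
      (hc.stronglyMeasurableAtFilter_nhdsWithin measurableSet_Icc x) (hc x hx)
  exact (h_int.const_add (f 0)).congr h.eq_add_integral (h.eq_add_integral x hx)

theorem deriv_eq_zero_of_eq_zero (h : IsPrimitive l f f') (hl : 0 < l)
    (hc : ContinuousOn f' (Set.Icc 0 l)) (hf : ∀ x ∈ Set.Icc 0 l, f x = 0)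
    (hx : x ∈ Set.Icc 0 l) : f' x = 0 :=
  (uniqueDiffOn_Icc hl x hx).eq_deriv _ (h.hasDerivWithinAt hc hx)
    ((hasDerivWithinAt_const x (Set.Icc 0 l) (0 : 𝕜)).congr hf (hf x hx))

theorem add (hf : IsPrimitive l f f') (hg : IsPrimitive l g g') :
    IsPrimitive l (fun x => f x + g x) (fun x => f' x + g' x) :=
  ⟨hf.intervalIntegrable.add hg.intervalIntegrable, fun x hx => by
    rw [intervalIntegral.integral_add (hf.mono hx).intervalIntegrable
      (hg.mono hx).intervalIntegrable, hf.eq_add_integral x hx, hg.eq_add_integral x hx]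
    ring⟩

theorem const_mul (hf : IsPrimitive l f f') (c : 𝕜) :
    IsPrimitive l (fun x => c * f x) (fun x => c * f' x) :=
  ⟨hf.intervalIntegrable.const_mul c, fun x hx => by
    rw [intervalIntegral.integral_const_mul, hf.eq_add_integral x hx]
    ring⟩

theorem sub (hf : IsPrimitive l f f') (hg : IsPrimitive l g g') :
    IsPrimitive l (fun x => f x - g x) (fun x => f' x - g' x) := by
  simpa only [neg_one_mul, ← sub_eq_add_neg] using hf.add (hg.const_mul (-1))

theorem map_conj (hf : IsPrimitive l f f') :
    IsPrimitive l (fun x => (starRingEnd 𝕜) (f x)) (fun x => (starRingEnd 𝕜) (f' x)) := by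
  let σ : 𝕜 →L[ℝ] 𝕜 := RCLike.conjCLE.toContinuousLinearMap
  refine ⟨⟨σ.integrable_comp hf.intervalIntegrable.1, σ.integrable_comp hf.intervalIntegrable.2⟩,
    fun x hx => ?_⟩
  rw [hf.eq_add_integral x hx, map_add]
  exact congrArg _ (σ.intervalIntegral_comp_comm (hf.mono hx).intervalIntegrable).symm

theorem re {f f' : ℝ → ℂ} (hf : IsPrimitive l f f') :
    IsPrimitive l (fun x => (f x).re) (fun x => (f' x).re) := by
  refine ⟨⟨hf.intervalIntegrable.1.re, hf.intervalIntegrable.2.re⟩, fun x hx => ?_⟩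
  rw [hf.eq_add_integral x hx, add_re]
  exact congrArg _ (reCLM.intervalIntegral_comp_comm (hf.mono hx).intervalIntegrable).symm

theorem monotoneOn {f f' : ℝ → ℝ} (hf : IsPrimitive l f f')
    (hf' : ∀ x ∈ Set.Icc 0 l, 0 ≤ f' x) : MonotoneOn f (Set.Icc 0 l) := by
  intro x hx y hy hxy
  rw [hf.eq_add_integral x hx, hf.eq_add_integral y hy]
  refine add_le_add_right (intervalIntegral.integral_mono_interval le_rfl hx.1 hxy ?_
    (hf.mono hy).intervalIntegrable) _
  filter_upwards [ae_restrict_mem measurableSet_Ioc] with t ht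
  exact hf' t ⟨ht.1.le, ht.2.trans hy.2⟩

theorem reverse (hf : IsPrimitive l f f') (hl : 0 ≤ l) :
    IsPrimitive l (fun x => f (l - x)) (fun x => -f' (l - x)) := by
  refine ⟨?_, fun x hx => ?_⟩
  · simpa only [sub_self, sub_zero, Pi.neg_def] using
      (hf.intervalIntegrable.comp_sub_left l).symm.neg
  · have hlx : l - x ∈ Set.Icc 0 l := ⟨by linarith [hx.2], by linarith [hx.1]⟩
    have h_int := (hf.mono hlx).intervalIntegrable
    rw [hf.eq_add_integral _ hlx, sub_zero, hf.eq_add_integral l ⟨hl, le_rfl⟩,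
      intervalIntegral.integral_neg, intervalIntegral.integral_comp_sub_left (fun t => f' t) l,
      sub_zero, ← intervalIntegral.integral_add_adjacent_intervals h_int
        (h_int.symm.trans hf.intervalIntegrable)]
    ring

theorem mul (hf : IsPrimitive l f f') (hg : IsPrimitive l g g') (hl : 0 ≤ l) :
    IsPrimitive l (fun x => f x * g x) (fun x => f' x * g x + f x * g' x) := by
  have h_int : IntervalIntegrable (fun x => f' x * g x + f x * g' x) volume 0 l := by
    have hfc := hf.continuousOn hl
    have hgc := hg.continuousOn hl
    rw [← Set.uIcc_of_le hl] at hfc hgc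
    exact (hf.intervalIntegrable.mul_continuousOn hgc).add
      (hg.intervalIntegrable.continuousOn_mul hfc)
  refine ⟨h_int, fun x hx => ?_⟩
  have hf' := (hf.mono hx).intervalIntegrable
  have hg' := (hg.mono hx).intervalIntegrable
  have expand : ∀ t ∈ Set.uIcc 0 x, f' t * g t + f t * g' t
      = (g 0 * f' t + f 0 * g' t) + ((g' t * ∫ s in (0 : ℝ)..t, f' s)
        + f' t * ∫ s in (0 : ℝ)..t, g' s) := by
    intro t ht
    rw [Set.uIcc_of_le hx.1] at ht
    rw [hf.eq_add_integral t ⟨ht.1, ht.2.trans hx.2⟩, hg.eq_add_integral t ⟨ht.1, ht.2.trans hx.2⟩]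
    ring
  have hfF : IntervalIntegrable (fun t => g' t * ∫ s in (0 : ℝ)..t, f' s) volume 0 x :=
    hg'.mul_continuousOn (intervalIntegral.continuousOn_primitive_interval' hf' Set.left_mem_uIcc)
  have hgG : IntervalIntegrable (fun t => f' t * ∫ s in (0 : ℝ)..t, g' s) volume 0 x :=
    hf'.mul_continuousOn (intervalIntegral.continuousOn_primitive_interval' hg' Set.left_mem_uIcc)
  rw [intervalIntegral.integral_congr expand, intervalIntegral.integral_add
    ((hf'.const_mul _).add (hg'.const_mul _)) (hfF.add hgG), intervalIntegral.integral_add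
    (hf'.const_mul _) (hg'.const_mul _), intervalIntegral.integral_add hfF hgG,
    integral_mul_integral_add hx.1 hf' hg', intervalIntegral.integral_const_mul,
    intervalIntegral.integral_const_mul, hf.eq_add_integral x hx, hg.eq_add_integral x hx]
  ring

theorem pow_succ (hf : IsPrimitive l f f') (hl : 0 ≤ l) (n : ℕ) :
    IsPrimitive l (fun x => f x ^ (n + 1)) (fun x => (n + 1) * (f' x * f x ^ n)) := by
  induction n with
  | zero => simpa using hf
  | succ n ih =>
    refine ((ih.mul hf hl).congr_fun hl fun x _ => ?_).congr_deriv hl fun x _ => ?_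
    · ring
    · push_cast; ring

end IsPrimitive

theorem isPrimitive_integral {𝕜 : Type*} [RCLike 𝕜] {f : ℝ → 𝕜} {l : ℝ}
    (hf : IntervalIntegrable f volume 0 l) :
    IsPrimitive l (fun x => ∫ t in (0 : ℝ)..x, f t) f :=
  ⟨hf, fun x _ => by rw [intervalIntegral.integral_same, zero_add]⟩

theorem integrable_prod_comp_sub_mul {k h : ℝ → ℂ} {x : ℝ} (hk : Continuous k) (hx : 0 ≤ x)
    (hh : IntervalIntegrable h volume 0 x) :
    Integrable (Function.uncurry fun s t => k (s - t) * h t)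
      ((volume.restrict (Set.Ioc 0 x)).prod (volume.restrict (Set.Ioc 0 x))) := by
  obtain ⟨C, hC⟩ := (isCompact_Icc (a := -x) (b := x)).exists_bound_of_continuousOn hk.continuousOn
  have hsnd : Integrable (fun p : ℝ × ℝ => h p.2)
      ((volume.restrict (Set.Ioc 0 x)).prod (volume.restrict (Set.Ioc 0 x))) :=
    ((intervalIntegrable_iff_integrableOn_Ioc_of_le hx).1 hh).comp_snd _
  refine hsnd.bdd_mul (c := C) (f := fun p : ℝ × ℝ => k (p.1 - p.2)) (by fun_prop) ?_
  rw [Measure.prod_restrict]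
  filter_upwards [ae_restrict_mem (measurableSet_Ioc.prod measurableSet_Ioc)]
    with p ⟨⟨hs, hs'⟩, ⟨ht, ht'⟩⟩
  exact hC _ ⟨by linarith, by linarith⟩

theorem isPrimitive_convolution {l : ℝ} (hl : 0 ≤ l) {g g' h : ℝ → ℂ}
    (hg : ∀ x, HasDerivAt g (g' x) x) (hg' : Continuous g')
    (hh : IntervalIntegrable h volume 0 l) :
    IsPrimitive l (fun x => ∫ t in (0 : ℝ)..x, g (x - t) * h t)
      (fun x => g 0 * h x + ∫ t in (0 : ℝ)..x, g' (x - t) * h t) := by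
  have hgc : Continuous g := continuous_iff_continuousAt.2 fun x => (hg x).continuousAt
  refine ⟨(hh.const_mul _).add
    (integral_triangle_swap hl (integrable_prod_comp_sub_mul hg' hl hh)).1, fun x hx => ?_⟩
  have hhx := intervalIntegrable_of_mem_Icc hh hx
  obtain ⟨h_int, hswap⟩ := integral_triangle_swap hx.1 (integrable_prod_comp_sub_mul hg' hx.1 hhx)
  have inner : ∀ t, ∫ s in t..x, g' (s - t) * h t = g (x - t) * h t - g 0 * h t := by
    intro t
    rw [intervalIntegral.integral_mul_const, intervalIntegral.integral_comp_sub_right g',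
      intervalIntegral.integral_eq_sub_of_hasDerivAt (fun y _ => hg y)
        (hg'.intervalIntegrable _ _), sub_self, sub_mul]
  have hconv : IntervalIntegrable (fun t => g (x - t) * h t) volume 0 x :=
    hhx.continuousOn_mul (by fun_prop)
  rw [intervalIntegral.integral_add (hhx.const_mul _) h_int, hswap,
    intervalIntegral.integral_congr fun t _ => inner t,
    intervalIntegral.integral_sub hconv (hhx.const_mul _), intervalIntegral.integral_same]
  ring

theorem zeta_pow_three (k : Fin 3) : zeta k ^ 3 = 1 := by
  have hsqrt : ((Real.sqrt 3 : ℝ) : ℂ) ^ 2 = 3 := by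
    exact_mod_cast Real.sq_sqrt (show (0 : ℝ) ≤ 3 by norm_num)
  fin_cases k <;> simp only [zeta, Fin.reduceFinMk, Matrix.cons_val]
  · ring
  · linear_combination (1 / 8 : ℂ) * (I * (√3 : ℂ) - 3) * (-hsqrt + (√3 : ℂ) ^ 2 * I_sq)
  · linear_combination (1 / 8 : ℂ) * (-I * (√3 : ℂ) - 3) * (-hsqrt + (√3 : ℂ) ^ 2 * I_sq)

theorem norm_zeta (k : Fin 3) : ‖zeta k‖ = 1 :=
  norm_eq_one_of_pow_eq_one (zeta_pow_three k) three_ne_zero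

theorem zeta_ne_zero (k : Fin 3) : zeta k ≠ 0 := by
  rw [← norm_ne_zero_iff, norm_zeta]
  exact one_ne_zero

theorem sum_zeta : ∑ k, zeta k = 0 := by
  simp only [Fin.sum_univ_three, zeta, Matrix.cons_val]
  ring

theorem sum_inv_zeta_pow (p : Fin 3) : ∑ k, 1 / zeta k ^ (p : ℕ) = if p = 0 then 3 else 0 := by
  fin_cases p
  · simp
  · have hconj : ∀ k, 1 / zeta k = (starRingEnd ℂ) (zeta k) := fun k => by
      rw [one_div, Complex.inv_def, normSq_eq_norm_sq, norm_zeta]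
      simp
    simp [hconj, ← map_sum, sum_zeta]
  · have hsq : ∀ k, 1 / zeta k ^ 2 = zeta k := fun k => by
      rw [div_eq_iff (pow_ne_zero _ (zeta_ne_zero k)), ← pow_succ', zeta_pow_three]
    simp [hsq, sum_zeta]

theorem freeSol_zero_left (p : Fin 3) (x : ℝ) :
    freeSol p 0 x = (x : ℂ) ^ (p : ℕ) / ((p : ℕ).factorial : ℂ) :=
  if_pos rfl

theorem freeSol_of_ne_zero (p : Fin 3) {lam : ℂ} (hlam : lam ≠ 0) (x : ℝ) :
    freeSol p lam x
      = 1 / 3 * ∑ k, exp (I * lam * zeta k * x) / (I * lam * zeta k) ^ (p : ℕ) := by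
  rw [freeSol, if_neg hlam, sFun, mul_div_assoc, Finset.sum_div]
  refine congrArg _ (Finset.sum_congr rfl fun k _ => ?_)
  rw [one_div_mul_eq_div, div_div, mul_pow _ (zeta k), mul_comm (zeta k ^ _),
    mul_right_comm (I * lam)]

theorem freeSol_zero_right (p : Fin 3) (lam : ℂ) : freeSol p lam 0 = if p = 0 then 1 else 0 := by
  by_cases hlam : lam = 0
  · rw [hlam, freeSol_zero_left]
    fin_cases p <;> simp
  · rw [freeSol, if_neg hlam, sFun]
    simp only [ofReal_zero, mul_zero, zero_mul, exp_zero, mul_one, sum_inv_zeta_pow]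
    split_ifs with hp <;> simp [hp]

theorem hasDerivAt_sum_exp_div (lam : ℂ) (p : ℕ) (x : ℝ) :
    HasDerivAt (fun x : ℝ => 1 / 3 * ∑ k, exp (I * lam * zeta k * x) / (I * lam * zeta k) ^ p)
      (1 / 3 * ∑ k, exp (I * lam * zeta k * x) * (I * lam * zeta k) / (I * lam * zeta k) ^ p)
      x := by
  refine (HasDerivAt.fun_sum fun k _ => HasDerivAt.div_const ?_ _).const_mul _
  have hlin : HasDerivAt (fun x : ℝ => I * lam * zeta k * x) (I * lam * zeta k) x := by
    simpa using (ofRealCLM.hasDerivAt (x := x)).const_mul (I * lam * zeta k)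
  exact hlin.cexp

theorem I_mul_mul_zeta_ne_zero {lam : ℂ} (hlam : lam ≠ 0) (k : Fin 3) : I * lam * zeta k ≠ 0 :=
  mul_ne_zero (mul_ne_zero I_ne_zero hlam) (zeta_ne_zero k)

theorem hasDerivAt_freeSol_two (lam : ℂ) (x : ℝ) :
    HasDerivAt (freeSol 2 lam) (freeSol 1 lam x) x := by
  by_cases hlam : lam = 0
  · rw [hlam, funext (freeSol_zero_left 2), freeSol_zero_left]
    simpa using ((ofRealCLM.hasDerivAt (x := x)).pow 2).div_const 2
  · rw [funext (freeSol_of_ne_zero 2 hlam), freeSol_of_ne_zero 1 hlam]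
    refine (hasDerivAt_sum_exp_div lam 2 x).congr_deriv
      (congrArg _ (Finset.sum_congr rfl fun k _ => ?_))
    have := I_mul_mul_zeta_ne_zero hlam k
    simp only [Fin.val_one]
    field_simp

theorem hasDerivAt_freeSol_one (lam : ℂ) (x : ℝ) :
    HasDerivAt (freeSol 1 lam) (freeSol 0 lam x) x := by
  by_cases hlam : lam = 0
  · rw [hlam, funext (freeSol_zero_left 1), freeSol_zero_left]
    simpa using (hasDerivAt_id x).ofReal_comp
  · rw [funext (freeSol_of_ne_zero 1 hlam), freeSol_of_ne_zero 0 hlam]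
    refine (hasDerivAt_sum_exp_div lam 1 x).congr_deriv
      (congrArg _ (Finset.sum_congr rfl fun k _ => ?_))
    simp [mul_div_cancel_right₀ _ (I_mul_mul_zeta_ne_zero hlam k)]

theorem hasDerivAt_freeSol_zero (lam : ℂ) (x : ℝ) :
    HasDerivAt (freeSol 0 lam) ((I * lam) ^ 3 * freeSol 2 lam x) x := by
  by_cases hlam : lam = 0
  · rw [hlam, funext (freeSol_zero_left 0)]
    simpa using hasDerivAt_const x (1 : ℂ)
  · rw [funext (freeSol_of_ne_zero 0 hlam), freeSol_of_ne_zero 2 hlam, mul_left_comm,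
      Finset.mul_sum]
    refine (hasDerivAt_sum_exp_div lam 0 x).congr_deriv
      (congrArg _ (Finset.sum_congr rfl fun k _ => ?_))
    have := I_mul_mul_zeta_ne_zero hlam k
    have hcube : (I * lam) ^ 3 = (I * lam * zeta k) ^ 3 := by
      rw [mul_pow _ (zeta k), zeta_pow_three, mul_one]
    simp only [hcube, Fin.val_two]
    field_simp

theorem continuous_freeSol (p : Fin 3) (lam : ℂ) : Continuous (freeSol p lam) := by
  refine continuous_iff_continuousAt.2 fun x => ?_
  fin_cases p
  · exact (hasDerivAt_freeSol_zero lam x).continuousAt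
  · exact (hasDerivAt_freeSol_one lam x).continuousAt
  · exact (hasDerivAt_freeSol_two lam x).continuousAt

theorem norm_freeSol_le_of_re_le (p : Fin 3) {lam : ℂ} (hlam : lam ≠ 0) {x τ : ℝ} (hx : 0 ≤ x)
    (hτ : ∀ k, (I * lam * zeta k).re ≤ τ) :
    ‖freeSol p lam x‖ ≤ (‖lam‖ ^ (p : ℕ))⁻¹ * Real.exp (τ * x) := by
  have hterm : ∀ k, ‖exp (I * lam * zeta k * x) / (I * lam * zeta k) ^ (p : ℕ)‖
      ≤ (‖lam‖ ^ (p : ℕ))⁻¹ * Real.exp (τ * x) := by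
    intro k
    rw [norm_div, norm_pow, norm_mul, norm_mul, norm_I, norm_zeta, one_mul, mul_one, norm_exp,
      re_mul_ofReal, div_eq_inv_mul]
    gcongr
    exact hτ k
  have hsum := norm_sum_le_of_le Finset.univ fun k _ => hterm k
  rw [Finset.sum_const, Finset.card_univ, Fintype.card_fin, nsmul_eq_mul] at hsum
  rw [freeSol_of_ne_zero p hlam, norm_mul, show ‖(1 / 3 : ℂ)‖ = 1 / 3 by norm_num]
  push_cast at hsum
  linarith

theorem norm_le_mul_exp_of_hasDerivAt {g g' : ℝ → ℂ} {B τ x : ℝ} (hB : 0 ≤ B) (hτ : 0 ≤ τ)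
    (hg : ∀ x, HasDerivAt g (g' x) x) (h0 : g 0 = 0) (hx : 0 ≤ x)
    (hb : ∀ t ∈ Set.Icc 0 x, ‖g' t‖ ≤ B * Real.exp (τ * t)) :
    ‖g x‖ ≤ x * B * Real.exp (τ * x) := by
  have hsub := norm_image_sub_le_of_norm_deriv_le_segment' (C := B * Real.exp (τ * x))
    (fun t _ => (hg t).hasDerivWithinAt)
    (fun t ht => (hb t ⟨ht.1, ht.2.le⟩).trans (by gcongr; exact ht.2.le)) x ⟨hx, le_rfl⟩
  rw [h0, sub_zero, sub_zero] at hsub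
  linarith

theorem norm_freeSol_le (p : Fin 3) (lam : ℂ) {x : ℝ} (hx : 0 ≤ x) :
    ‖freeSol p lam x‖ ≤ x ^ (p : ℕ) * Real.exp (‖lam‖ * x) := by
  have h0 : ∀ t, 0 ≤ t → ‖freeSol 0 lam t‖ ≤ Real.exp (‖lam‖ * t) := by
    intro t ht
    by_cases hlam : lam = 0
    · simp [hlam, freeSol_zero_left]
    · simpa using norm_freeSol_le_of_re_le 0 hlam ht (τ := ‖lam‖) fun k =>
        (re_le_norm _).trans_eq (by simp [norm_zeta])
  have h1 : ∀ t, 0 ≤ t → ‖freeSol 1 lam t‖ ≤ t * Real.exp (‖lam‖ * t) := fun t ht => by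
    simpa using norm_le_mul_exp_of_hasDerivAt zero_le_one (norm_nonneg lam)
      (hasDerivAt_freeSol_one lam) (freeSol_zero_right 1 lam) ht
      fun s hs => by simpa using h0 s hs.1
  have h2 : ‖freeSol 2 lam x‖ ≤ x * x * Real.exp (‖lam‖ * x) :=
    norm_le_mul_exp_of_hasDerivAt hx (norm_nonneg lam) (hasDerivAt_freeSol_two lam)
      (freeSol_zero_right 2 lam) hx fun s hs => (h1 s hs.1).trans (by gcongr; exact hs.2)
  fin_cases p
  · simpa using h0 x hx
  · simpa using h1 x hx
  · simpa [sq] using h2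

theorem norm_freeSol_le_of_mem_Icc (p : Fin 3) (lam : ℂ) {x l : ℝ} (hx : x ∈ Set.Icc 0 l) :
    ‖freeSol p lam x‖ ≤ (1 + l) ^ 2 * Real.exp (‖lam‖ * x) := by
  refine (norm_freeSol_le p lam hx.1).trans ?_
  gcongr
  calc x ^ (p : ℕ) ≤ (1 + l) ^ (p : ℕ) := by
        have := hx.1
        gcongr
        linarith [hx.2]
    _ ≤ (1 + l) ^ 2 := pow_le_pow_right₀ (by linarith [hx.1, hx.2]) (by omega)

section VolterraSeries

variable {q : ℝ → ℝ} {l : ℝ}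

theorem intervalIntegrable_ofReal_mul {f : ℝ → ℂ} {x : ℝ} (hx : 0 ≤ x)
    (hq : IntervalIntegrable q volume 0 x) (hf : ContinuousOn f (Set.Icc 0 x)) :
    IntervalIntegrable (fun t => (q t : ℂ) * f t) volume 0 x := by
  rw [← Set.uIcc_of_le hx] at hf
  exact IntervalIntegrable.mul_continuousOn ⟨hq.1.ofReal, hq.2.ofReal⟩ hf

theorem norm_volterra_le {lam : ℂ} {C τ x : ℝ} {f : ℝ → ℂ} {g : ℝ → ℝ} (hx : 0 ≤ x)
    (hq : IntervalIntegrable q volume 0 x) (hg : ContinuousOn g (Set.Icc 0 x))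
    (hC : ∀ t ∈ Set.Icc 0 x, ‖freeSol 2 lam t‖ ≤ C * Real.exp (τ * t))
    (hf : ∀ t ∈ Set.Icc 0 x, ‖f t‖ ≤ g t * Real.exp (τ * t)) :
    ‖volterra q lam f x‖ ≤ C * Real.exp (τ * x) * ∫ t in (0 : ℝ)..x, |q t| * g t := by
  rw [← intervalIntegral.integral_const_mul]
  refine intervalIntegral.norm_integral_le_of_norm_le hx (.of_forall fun t ht => ?_) ?_
  · have htx : t ∈ Set.Icc 0 x := Set.Ioc_subset_Icc_self ht
    have hkernel := hC (x - t) ⟨by linarith [htx.2], by linarith [htx.1]⟩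
    have hexp : Real.exp (τ * x) = Real.exp (τ * (x - t)) * Real.exp (τ * t) := by
      rw [← Real.exp_add]
      ring_nf
    calc ‖freeSol 2 lam (x - t) * (q t : ℂ) * f t‖
        = ‖freeSol 2 lam (x - t)‖ * |q t| * ‖f t‖ := by
          rw [norm_mul, norm_mul, norm_real, Real.norm_eq_abs]
      _ ≤ (C * Real.exp (τ * (x - t))) * |q t| * (g t * Real.exp (τ * t)) := by
          gcongr
          · exact mul_nonneg ((norm_nonneg _).trans hkernel) (abs_nonneg _)
          · exact hf t htx
      _ = C * Real.exp (τ * x) * (|q t| * g t) := by rw [hexp]; ring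
  · rw [← Set.uIcc_of_le hx] at hg
    exact (hq.abs.mul_continuousOn hg).const_mul _

theorem norm_iterate_volterra_le {lam : ℂ} {A C τ : ℝ} {f : ℝ → ℂ}
    (hq : IntervalIntegrable q volume 0 l)
    (hC : ∀ t ∈ Set.Icc 0 l, ‖freeSol 2 lam t‖ ≤ C * Real.exp (τ * t))
    (hf : ∀ t ∈ Set.Icc 0 l, ‖f t‖ ≤ A * Real.exp (τ * t)) (n : ℕ) :
    ∀ x ∈ Set.Icc 0 l, ‖(volterra q lam)^[n] f x‖
      ≤ A * ((C * ∫ t in (0 : ℝ)..x, |q t|) ^ n / n.factorial) * Real.exp (τ * x) := by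
  induction n with
  | zero => simpa using hf
  | succ n ih =>
    intro x hx
    have hQ := (isPrimitive_integral hq.abs).mono hx
    have hQn := (hQ.pow_succ hx.1 n).eq_add_integral x ⟨hx.1, le_rfl⟩
    rw [intervalIntegral.integral_same, zero_pow n.succ_ne_zero, zero_add,
      intervalIntegral.integral_const_mul] at hQn
    rw [Function.iterate_succ_apply']
    refine (norm_volterra_le
      (g := fun t => A * ((C * ∫ s in (0 : ℝ)..t, |q s|) ^ n / n.factorial)) hx.1
      (intervalIntegrable_of_mem_Icc hq hx)
      (continuousOn_const.mul (((continuousOn_const.mul (hQ.continuousOn hx.1)).pow n).div_const _))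
      (fun t ht => hC t ⟨ht.1, ht.2.trans hx.2⟩)
      (fun t ht => ih t ⟨ht.1, ht.2.trans hx.2⟩)).trans_eq ?_
    have hfactor : ∀ t, |q t| * (A * ((C * ∫ s in (0 : ℝ)..t, |q s|) ^ n / n.factorial))
        = A * C ^ n / n.factorial * (|q t| * (∫ s in (0 : ℝ)..t, |q s|) ^ n) := fun t => by ring
    simp only [hfactor]
    rw [intervalIntegral.integral_const_mul, mul_pow, hQn, Nat.factorial_succ]
    push_cast
    field_simp
    ring

theorem continuousOn_volterra {lam : ℂ} {f : ℝ → ℂ} (hl : 0 ≤ l)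
    (hq : IntervalIntegrable q volume 0 l) (hf : ContinuousOn f (Set.Icc 0 l)) :
    ContinuousOn (volterra q lam f) (Set.Icc 0 l) := by
  refine ((isPrimitive_convolution hl (hasDerivAt_freeSol_two lam) (continuous_freeSol 1 lam)
    (intervalIntegrable_ofReal_mul hl hq hf)).continuousOn hl).congr fun x _ => ?_
  simp only [volterra, mul_assoc]

theorem hasSum_volterra {lam : ℂ} {F : ℕ → ℝ → ℂ} {M : ℕ → ℝ} {x : ℝ} (hx : 0 ≤ x)
    (hq : IntervalIntegrable q volume 0 x) (hF : ∀ n, ContinuousOn (F n) (Set.Icc 0 x))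
    (hM : Summable M) (hFM : ∀ n, ∀ t ∈ Set.Icc 0 x, ‖F n t‖ ≤ M n) :
    HasSum (fun n => volterra q lam (F n) x) (volterra q lam (fun t => ∑' n, F n t) x) := by
  have hkernel : ContinuousOn (fun t => freeSol 2 lam (x - t)) (Set.uIcc 0 x) :=
    ((continuous_freeSol 2 lam).comp (continuous_const.sub continuous_id)).continuousOn
  have hkq : IntervalIntegrable (fun t => freeSol 2 lam (x - t) * (q t : ℂ)) volume 0 x :=
    IntervalIntegrable.continuousOn_mul ⟨hq.1.ofReal, hq.2.ofReal⟩ hkernel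
  refine intervalIntegral.hasSum_integral_of_dominated_convergence
    (fun n t => ‖freeSol 2 lam (x - t) * (q t : ℂ)‖ * M n) (fun n => ?_)
    (fun n => .of_forall fun t ht => ?_) (.of_forall fun t _ => hM.mul_left _) ?_
    (.of_forall fun t ht => ?_)
  · have hFn := hF n
    rw [← Set.uIcc_of_le hx] at hFn
    exact (hkq.mul_continuousOn hFn).def'.aestronglyMeasurable
  · rw [Set.uIoc_of_le hx] at ht
    rw [norm_mul]
    gcongr
    exact hFM n t (Set.Ioc_subset_Icc_self ht)
  · simp only [tsum_mul_left]
    exact hkq.norm.mul_const _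
  · rw [Set.uIoc_of_le hx] at ht
    exact (Summable.of_norm_bounded hM fun n =>
      hFM n t (Set.Ioc_subset_Icc_self ht)).hasSum.mul_left _

theorem continuousOn_iterate_volterra_freeSol (hl : 0 ≤ l) (hq : IntervalIntegrable q volume 0 l)
    (p : Fin 3) (lam : ℂ) (n : ℕ) :
    ContinuousOn ((volterra q lam)^[n] (freeSol p lam)) (Set.Icc 0 l) := by
  induction n with
  | zero => exact (continuous_freeSol p lam).continuousOn
  | succ n ih =>
    rw [Function.iterate_succ']
    exact continuousOn_volterra hl hq ih

theorem exists_summable_iterate_volterra_bound (hq : IntervalIntegrable q volume 0 l)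
    (p : Fin 3) (lam : ℂ) : ∃ M : ℕ → ℝ, Summable M ∧ ∀ n, ∀ x ∈ Set.Icc 0 l,
      ‖I ^ n * (volterra q lam)^[n] (freeSol p lam) x‖ ≤ M n := by
  refine ⟨fun n => (1 + l) ^ 2 * (((1 + l) ^ 2 * ∫ t in (0 : ℝ)..l, |q t|) ^ n / n.factorial)
    * Real.exp (‖lam‖ * l), ((Real.summable_pow_div_factorial _).mul_left _).mul_right _,
    fun n x hx => ?_⟩
  have hl : 0 ≤ l := hx.1.trans hx.2
  rw [norm_mul, norm_pow, norm_I, one_pow, one_mul]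
  refine (norm_iterate_volterra_le hq (fun t ht => norm_freeSol_le_of_mem_Icc 2 lam ht)
    (fun t ht => norm_freeSol_le_of_mem_Icc p lam ht) n x hx).trans ?_
  have hmono : ∫ t in (0 : ℝ)..x, |q t| ≤ ∫ t in (0 : ℝ)..l, |q t| :=
    intervalIntegral.integral_mono_interval le_rfl hx.1 hx.2
      (.of_forall fun t => abs_nonneg _) hq.abs
  have hnonneg : 0 ≤ ∫ t in (0 : ℝ)..x, |q t| :=
    intervalIntegral.integral_nonneg hx.1 fun t _ => abs_nonneg _
  have hnonneg' := hnonneg.trans hmono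
  beta_reduce
  gcongr
  exact hx.2

theorem continuousOn_fundSol (hl : 0 ≤ l) (hq : IntervalIntegrable q volume 0 l) (p : Fin 3)
    (lam : ℂ) : ContinuousOn (fundSol q p lam) (Set.Icc 0 l) := by
  obtain ⟨M, hM, hbound⟩ := exists_summable_iterate_volterra_bound hq p lam
  exact continuousOn_tsum (fun n => continuousOn_const.mul
    (continuousOn_iterate_volterra_freeSol hl hq p lam n)) hM hbound

theorem volterra_const_mul (lam c : ℂ) (f : ℝ → ℂ) (x : ℝ) :
    volterra q lam (fun t => c * f t) x = c * volterra q lam f x := by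
  simp only [volterra, mul_left_comm _ c, intervalIntegral.integral_const_mul]

theorem fundSol_eq_freeSol_add_volterra (hq : IntervalIntegrable q volume 0 l) (p : Fin 3)
    (lam : ℂ) {x : ℝ} (hx : x ∈ Set.Icc 0 l) :
    fundSol q p lam x = freeSol p lam x + I * volterra q lam (fundSol q p lam) x := by
  have hqx := intervalIntegrable_of_mem_Icc hq hx
  obtain ⟨F, hF⟩ : ∃ F : ℕ → ℝ → ℂ,
      ∀ n, F n = fun t => I ^ n * (volterra q lam)^[n] (freeSol p lam) t := ⟨_, fun _ => rfl⟩
  have hzero : F 0 x = freeSol p lam x := by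
    simp only [hF, pow_zero, one_mul, Function.iterate_zero, id]
  have hsucc : ∀ n, F (n + 1) x = I * volterra q lam (F n) x := fun n => by
    simp only [hF, volterra_const_mul, Function.iterate_succ_apply', pow_succ', mul_assoc]
  have hfund : ∀ t, fundSol q p lam t = ∑' n, F n t := fun t => by simp only [hF, fundSol]
  obtain ⟨M, hM, hbound⟩ := exists_summable_iterate_volterra_bound hqx p lam
  have hcont : ∀ n, ContinuousOn (F n) (Set.Icc 0 x) := fun n => hF n ▸
    continuousOn_const.mul (continuousOn_iterate_volterra_freeSol hx.1 hqx p lam n)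
  have hsum := (hasSum_volterra (lam := lam) hx.1 hqx hcont hM
    fun n t ht => by simpa only [hF] using hbound n t ht).mul_left I
  simp only [← hsucc] at hsum
  rw [hfund, funext hfund, ((summable_nat_add_iff 1).1 hsum.summable).tsum_eq_zero_add,
    hsum.tsum_eq, hzero]

theorem norm_fundSol_le {lam : ℂ} {p : Fin 3} {A C τ : ℝ} (hq : IntervalIntegrable q volume 0 l)
    (hC : ∀ t ∈ Set.Icc 0 l, ‖freeSol 2 lam t‖ ≤ C * Real.exp (τ * t))
    (hA : ∀ t ∈ Set.Icc 0 l, ‖freeSol p lam t‖ ≤ A * Real.exp (τ * t)) {x : ℝ}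
    (hx : x ∈ Set.Icc 0 l) :
    ‖fundSol q p lam x‖
      ≤ A * Real.exp (C * ∫ t in (0 : ℝ)..x, |q t|) * Real.exp (τ * x) := by
  have hexp := ((NormedSpace.expSeries_div_hasSum_exp
    (C * ∫ t in (0 : ℝ)..x, |q t|)).mul_left A).mul_right (Real.exp (τ * x))
  rw [← Real.exp_eq_exp_ℝ] at hexp
  refine tsum_of_norm_bounded hexp fun n => ?_
  rw [norm_mul, norm_pow, norm_I, one_pow, one_mul]
  exact norm_iterate_volterra_le hq hC hA n x hx

theorem norm_fundSol_sub_freeSol_le {lam : ℂ} {p : Fin 3} {A C τ : ℝ} (hl : 0 ≤ l)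
    (hq : IntervalIntegrable q volume 0 l)
    (hC : ∀ t ∈ Set.Icc 0 l, ‖freeSol 2 lam t‖ ≤ C * Real.exp (τ * t))
    (hA : ∀ t ∈ Set.Icc 0 l, ‖freeSol p lam t‖ ≤ A * Real.exp (τ * t)) :
    ‖fundSol q p lam l - freeSol p lam l‖ ≤ C * (∫ t in (0 : ℝ)..l, |q t|) * A
      * Real.exp (C * ∫ t in (0 : ℝ)..l, |q t|) * Real.exp (τ * l) := by
  rw [fundSol_eq_freeSol_add_volterra hq p lam ⟨hl, le_rfl⟩, add_sub_cancel_left, norm_mul,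
    norm_I, one_mul]
  have hC0 : 0 ≤ C := by
    simpa using (norm_nonneg _).trans (hC 0 ⟨le_rfl, hl⟩)
  have hA0 : 0 ≤ A := by
    simpa using (norm_nonneg _).trans (hA 0 ⟨le_rfl, hl⟩)
  have hmono : ∀ t ∈ Set.Icc 0 l, ∫ s in (0 : ℝ)..t, |q s| ≤ ∫ s in (0 : ℝ)..l, |q s| :=
    fun t ht => intervalIntegral.integral_mono_interval le_rfl ht.1 ht.2
      (.of_forall fun s => abs_nonneg _) hq.abs
  refine (norm_volterra_le (g := fun _ => A * Real.exp (C * ∫ s in (0 : ℝ)..l, |q s|)) hl hq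
    continuousOn_const hC fun t ht => (norm_fundSol_le hq hC hA ht).trans ?_).trans_eq ?_
  · gcongr
    exact hmono t ht
  · rw [intervalIntegral.integral_mul_const]
    ring

end VolterraSeries

theorem IsPrimitive.of_hasDerivAt {g g' : ℝ → ℂ} (l : ℝ) (hg : ∀ x, HasDerivAt g (g' x) x)
    (hc : Continuous g') : IsPrimitive l g g' := by
  refine ⟨hc.intervalIntegrable _ _, fun x _ => ?_⟩
  rw [intervalIntegral.integral_eq_sub_of_hasDerivAt (fun y _ => hg y) (hc.intervalIntegrable _ _)]
  ring

/-- `u` solves `u''' = c u` on `[0, l]` in the sense of Carathéodory, with first and second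
derivatives `u1` and `u2`. -/
structure IsSol (c : ℝ → ℂ) (l : ℝ) (u u1 u2 : ℝ → ℂ) : Prop where
  prim : IsPrimitive l u u1
  prim1 : IsPrimitive l u1 u2
  prim2 : IsPrimitive l u2 (fun x => c x * u x)

namespace IsSol

variable {c d : ℝ → ℂ} {l x : ℝ} {u u1 u2 v v1 v2 : ℝ → ℂ}

theorem mono (h : IsSol c l u u1 u2) (hx : x ∈ Set.Icc 0 l) : IsSol c x u u1 u2 :=
  ⟨h.prim.mono hx, h.prim1.mono hx, h.prim2.mono hx⟩

theorem lagrange (hu : IsSol c l u u1 u2) (hv : IsSol d l v v1 v2) (hl : 0 ≤ l) :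
    u2 l * v l - u1 l * v1 l + u l * v2 l = u2 0 * v 0 - u1 0 * v1 0 + u 0 * v2 0
      + ∫ t in (0 : ℝ)..l, (c t + d t) * (u t * v t) := by
  have h := ((hu.prim2.mul hv.prim hl).sub (hu.prim1.mul hv.prim1 hl)).add
    (hu.prim.mul hv.prim2 hl)
  rw [h.eq_add_integral l ⟨hl, le_rfl⟩]
  congr 1
  exact intervalIntegral.integral_congr fun t _ => by ring

theorem add (hu : IsSol c l u u1 u2) (hv : IsSol c l v v1 v2) (hl : 0 ≤ l) :
    IsSol c l (fun x => u x + v x) (fun x => u1 x + v1 x) (fun x => u2 x + v2 x) :=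
  ⟨hu.prim.add hv.prim, hu.prim1.add hv.prim1,
    (hu.prim2.add hv.prim2).congr_deriv hl fun x _ => by ring⟩

theorem const_mul (hu : IsSol c l u u1 u2) (hl : 0 ≤ l) (a : ℂ) :
    IsSol c l (fun x => a * u x) (fun x => a * u1 x) (fun x => a * u2 x) :=
  ⟨hu.prim.const_mul a, hu.prim1.const_mul a,
    (hu.prim2.const_mul a).congr_deriv hl fun x _ => by ring⟩

theorem map_conj (hu : IsSol c l u u1 u2) (hl : 0 ≤ l) :
    IsSol (fun x => (starRingEnd ℂ) (c x)) l (fun x => (starRingEnd ℂ) (u x))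
      (fun x => (starRingEnd ℂ) (u1 x)) (fun x => (starRingEnd ℂ) (u2 x)) :=
  ⟨hu.prim.map_conj, hu.prim1.map_conj,
    hu.prim2.map_conj.congr_deriv hl fun x _ => by rw [map_mul]⟩

theorem congr_coeff (hu : IsSol c l u u1 u2) (hl : 0 ≤ l) (h : ∀ x ∈ Set.Icc 0 l, c x = d x) :
    IsSol d l u u1 u2 :=
  ⟨hu.prim, hu.prim1, hu.prim2.congr_deriv hl fun x hx => by rw [h x hx]⟩

theorem reverse (hu : IsSol c l u u1 u2) (hl : 0 ≤ l) :
    IsSol (fun x => -c (l - x)) l (fun x => u (l - x)) (fun x => -u1 (l - x))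
      (fun x => u2 (l - x)) :=
  ⟨hu.prim.reverse hl,
    (((hu.prim1.reverse hl).const_mul (-1)).congr_fun hl fun x _ => by ring).congr_deriv hl
      fun x _ => by ring,
    (hu.prim2.reverse hl).congr_deriv hl fun x _ => by ring⟩

theorem wronskian (hu : IsSol c l u u1 u2) (hv : IsSol c l v v1 v2) (hl : 0 ≤ l) :
    IsSol (fun x => -c x) l (fun x => u x * v1 x - v x * u1 x) (fun x => u x * v2 x - v x * u2 x)
      (fun x => u1 x * v2 x - v1 x * u2 x) :=
  ⟨((hu.prim.mul hv.prim1 hl).sub (hv.prim.mul hu.prim1 hl)).congr_deriv hl fun x _ => by ring,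
    ((hu.prim.mul hv.prim2 hl).sub (hv.prim.mul hu.prim2 hl)).congr_deriv hl fun x _ => by ring,
    ((hu.prim1.mul hv.prim2 hl).sub (hv.prim1.mul hu.prim2 hl)).congr_deriv hl
      fun x _ => by ring⟩

theorem continuousOn (hu : IsSol c l u u1 u2) (hl : 0 ≤ l) : ContinuousOn u (Set.Icc 0 l) :=
  hu.prim.continuousOn hl

theorem derivs_eq_zero (hu : IsSol c l u u1 u2) (hl : 0 < l) (h : ∀ x ∈ Set.Icc 0 l, u x = 0)
    (hx : x ∈ Set.Icc 0 l) : u1 x = 0 ∧ u2 x = 0 := by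
  have h1 : ∀ x ∈ Set.Icc 0 l, u1 x = 0 := fun x hx =>
    hu.prim.deriv_eq_zero_of_eq_zero hl (hu.prim1.continuousOn hl.le) h hx
  exact ⟨h1 x hx, hu.prim1.deriv_eq_zero_of_eq_zero hl (hu.prim2.continuousOn hl.le) h1 hx⟩

end IsSol

/-- The coefficient `c` for which the equation `i y''' + q y = z y` reads `y''' = c y`. -/
def coeff (q : ℝ → ℝ) (z : ℂ) (x : ℝ) : ℂ := -I * (z - q x)

/-- `u` is the fundamental solution of `i y''' + q y = z y` on `[0, l]` with initial data
`u^{(k)}(0) = δ_{kp}`; here `z` corresponds to `λ³`. -/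
structure IsFundSol (q : ℝ → ℝ) (l : ℝ) (p : Fin 3) (z : ℂ) (u u1 u2 : ℝ → ℂ) : Prop
    extends IsSol (coeff q z) l u u1 u2 where
  init : u 0 = if p = 0 then 1 else 0
  init1 : u1 0 = if p = 1 then 1 else 0
  init2 : u2 0 = if p = 2 then 1 else 0

section FundamentalSolutions

variable {q : ℝ → ℝ} {l x : ℝ}

theorem isSol_of_volterra (hl : 0 ≤ l) (hq : IntervalIntegrable q volume 0 l) {lam : ℂ}
    {e e1 e2 u : ℝ → ℂ} (he : ∀ x, HasDerivAt e (e1 x) x) (he1 : ∀ x, HasDerivAt e1 (e2 x) x)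
    (he2 : ∀ x, HasDerivAt e2 ((I * lam) ^ 3 * e x) x) (hu : ContinuousOn u (Set.Icc 0 l))
    (heq : ∀ x ∈ Set.Icc 0 l, e x + I * volterra q lam u x = u x) :
    ∃ u1 u2, IsSol (coeff q (lam ^ 3)) l u u1 u2 ∧ u 0 = e 0 ∧ u1 0 = e1 0 ∧ u2 0 = e2 0 := by
  have hqu := intervalIntegrable_ofReal_mul hl hq hu
  have hcont : ∀ {g g' : ℝ → ℂ}, (∀ x, HasDerivAt g (g' x) x) → Continuous g := fun hg =>
    continuous_iff_continuousAt.2 fun x => (hg x).continuousAt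
  have p0 := (IsPrimitive.of_hasDerivAt l he (hcont he1)).add
    ((isPrimitive_convolution hl (hasDerivAt_freeSol_two lam) (continuous_freeSol 1 lam)
      hqu).const_mul I)
  have p1 := (IsPrimitive.of_hasDerivAt l he1 (hcont he2)).add
    ((isPrimitive_convolution hl (hasDerivAt_freeSol_one lam) (continuous_freeSol 0 lam)
      hqu).const_mul I)
  have p2 := (IsPrimitive.of_hasDerivAt l he2 ((hcont he).const_mul _)).add
    ((isPrimitive_convolution hl (hasDerivAt_freeSol_zero lam)
      ((continuous_freeSol 2 lam).const_mul _) hqu).const_mul I)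
  simp only [freeSol_zero_right, Fin.reduceEq, if_true, if_false, zero_mul, zero_add, one_mul,
    mul_assoc ((I * lam) ^ 3), intervalIntegral.integral_const_mul] at p0 p1 p2
  simp only [volterra, mul_assoc] at heq
  refine ⟨_, _, ⟨p0.congr_fun hl heq, p1, p2.congr_deriv hl fun x hx => ?_⟩, ?_, ?_, ?_⟩
  · rw [← heq x hx, coeff]
    linear_combination (I * lam ^ 3 * (e x + I * ∫ t in (0 : ℝ)..x,
      freeSol 2 lam (x - t) * ((q t : ℂ) * u t))) * I_sq
  · simp [← heq 0 ⟨le_rfl, hl⟩]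
  · simp
  · simp

theorem exists_isFundSol (hl : 0 ≤ l) (hq : IntervalIntegrable q volume 0 l) (p : Fin 3)
    (lam : ℂ) : ∃ u1 u2, IsFundSol q l p (lam ^ 3) (fundSol q p lam) u1 u2 := by
  have hsol := fun {e1 e2} he he1 he2 => isSol_of_volterra (e := freeSol p lam) (e1 := e1)
    (e2 := e2) hl hq he he1 he2 (continuousOn_fundSol hl hq p lam)
    fun x hx => (fundSol_eq_freeSol_add_volterra hq p lam hx).symm
  fin_cases p
  · obtain ⟨u1, u2, hu, h0, h1, h2⟩ := hsol (hasDerivAt_freeSol_zero lam)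
      (fun x => (hasDerivAt_freeSol_two lam x).const_mul _)
      (fun x => (hasDerivAt_freeSol_one lam x).const_mul _)
    exact ⟨u1, u2, hu, by simpa [freeSol_zero_right] using h0,
      by simpa [freeSol_zero_right] using h1, by simpa [freeSol_zero_right] using h2⟩
  · obtain ⟨u1, u2, hu, h0, h1, h2⟩ := hsol (hasDerivAt_freeSol_one lam)
      (hasDerivAt_freeSol_zero lam) (fun x => (hasDerivAt_freeSol_two lam x).const_mul _)
    exact ⟨u1, u2, hu, by simpa [freeSol_zero_right] using h0,
      by simpa [freeSol_zero_right] using h1, by simpa [freeSol_zero_right] using h2⟩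
  · obtain ⟨u1, u2, hu, h0, h1, h2⟩ := hsol (hasDerivAt_freeSol_two lam)
      (hasDerivAt_freeSol_one lam) (hasDerivAt_freeSol_zero lam)
    exact ⟨u1, u2, hu, by simpa [freeSol_zero_right] using h0,
      by simpa [freeSol_zero_right] using h1, by simpa [freeSol_zero_right] using h2⟩

theorem IsSol.fundSolDerivEnd_eq {p : Fin 3} {lam : ℂ} {c u1 u2 : ℝ → ℂ}
    (h : IsSol c l (fundSol q p lam) u1 u2) (hl : 0 < l) : fundSolDerivEnd q l p lam = u1 l :=
  (h.prim.hasDerivWithinAt (h.prim1.continuousOn hl.le) ⟨hl.le, le_rfl⟩).derivWithin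
    (uniqueDiffOn_Icc hl l ⟨hl.le, le_rfl⟩)

/-- The principal cube root. -/
def cbrt (z : ℂ) : ℂ := z ^ (1 / 3 : ℂ)

theorem cbrt_pow_three (z : ℂ) : cbrt z ^ 3 = z := by
  rw [cbrt, ← cpow_nat_mul]
  norm_num

theorem norm_cbrt (z : ℂ) : ‖cbrt z‖ = ‖z‖ ^ (1 / 3 : ℝ) := by
  have h : ‖cbrt z‖ ^ 3 = ‖z‖ := by rw [← norm_pow, cbrt_pow_three]
  rw [← h, ← Real.rpow_natCast, ← Real.rpow_mul (norm_nonneg _)]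
  norm_num

theorem exists_variation_of_constants (hq : IntervalIntegrable q volume 0 l)
    (hx : x ∈ Set.Icc 0 l) (w : ℂ) :
    ∃ (k : ℝ → ℂ) (a0 a1 a2 : ℂ), ContinuousOn k (Set.Icc 0 x) ∧
      ∀ (z : ℂ) (u u1 u2 : ℝ → ℂ), IsSol (coeff q z) l u u1 u2 →
        u x = a0 * u 0 + a1 * u1 0 + a2 * u2 0 - I * (z - w) * ∫ t in (0 : ℝ)..x, u t * k t := by
  have hq' : IntervalIntegrable (fun t => q (x - t)) volume 0 x := by
    simpa only [sub_self, sub_zero] using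
      ((intervalIntegrable_of_mem_Icc hq hx).comp_sub_left x).symm
  -- The kernel is the fundamental solution for the reversed potential, run backwards from `x`.
  obtain ⟨s1, s2, hs⟩ := exists_isFundSol hx.1 hq' 2 (cbrt w)
  set s := fundSol (fun t => q (x - t)) 2 (cbrt w)
  have hr := hs.toIsSol.reverse hx.1
  refine ⟨fun t => s (x - t), s2 x, s1 x, s x, hr.continuousOn hx.1, fun z u u1 u2 hu => ?_⟩
  have hlagrange := (hu.mono hx).lagrange hr hx.1
  have hcoeff : ∀ t, (coeff q z t + -coeff (fun t => q (x - t)) (cbrt w ^ 3) (x - t))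
      * (u t * s (x - t)) = -(I * (z - w)) * (u t * s (x - t)) := fun t => by
    simp only [coeff, cbrt_pow_three, sub_sub_cancel]
    ring
  simp only [hcoeff, intervalIntegral.integral_const_mul, sub_self, sub_zero, hs.init, hs.init1,
    hs.init2, Fin.reduceEq, if_true, if_false] at hlagrange
  linear_combination hlagrange

theorem IsFundSol.unique {p : Fin 3} {z : ℂ} {u u1 u2 v v1 v2 : ℝ → ℂ}
    (hu : IsFundSol q l p z u u1 u2) (hv : IsFundSol q l p z v v1 v2)
    (hq : IntervalIntegrable q volume 0 l) (hx : x ∈ Set.Icc 0 l) : u x = v x := by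
  obtain ⟨k, a0, a1, a2, -, hk⟩ := exists_variation_of_constants hq hx z
  rw [hk z u u1 u2 hu.toIsSol, hk z v v1 v2 hv.toIsSol, hu.init, hu.init1, hu.init2, hv.init,
    hv.init1, hv.init2, sub_self, mul_zero, zero_mul, zero_mul]

/-- The fundamental solutions as functions of the spectral parameter `z = λ³`, in which they are
entire; any choice of the cube root gives the same function. -/
def specSol (q : ℝ → ℝ) (p : Fin 3) (z : ℂ) (x : ℝ) : ℂ := fundSol q p (cbrt z) x

theorem exists_isFundSol_specSol (hl : 0 ≤ l) (hq : IntervalIntegrable q volume 0 l) (p : Fin 3)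
    (z : ℂ) : ∃ u1 u2, IsFundSol q l p z (specSol q p z) u1 u2 := by
  have h := exists_isFundSol hl hq p (cbrt z)
  rwa [cbrt_pow_three] at h

theorem fundSol_eq_specSol (hq : IntervalIntegrable q volume 0 l) (p : Fin 3) (lam : ℂ)
    (hx : x ∈ Set.Icc 0 l) : fundSol q p lam x = specSol q p (lam ^ 3) x := by
  have hl := hx.1.trans hx.2
  obtain ⟨u1, u2, hu⟩ := exists_isFundSol hl hq p lam
  obtain ⟨v1, v2, hv⟩ := exists_isFundSol_specSol hl hq p (lam ^ 3)
  exact hu.unique hv hq hx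

theorem norm_specSol_le (hq : IntervalIntegrable q volume 0 l) (p : Fin 3) (z : ℂ)
    (hx : x ∈ Set.Icc 0 l) : ‖specSol q p z x‖ ≤ (1 + l) ^ 2
      * Real.exp ((1 + l) ^ 2 * ∫ t in (0 : ℝ)..l, |q t|) * Real.exp (‖z‖ ^ (1 / 3 : ℝ) * l) := by
  have hl := hx.1.trans hx.2
  have hfund := norm_fundSol_le hq (fun t ht => norm_freeSol_le_of_mem_Icc 2 (cbrt z) ht)
    (fun t ht => norm_freeSol_le_of_mem_Icc p (cbrt z) ht) hx
  rw [norm_cbrt] at hfund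
  refine hfund.trans ?_
  gcongr
  · exact intervalIntegral.integral_mono_interval le_rfl hx.1 hx.2
      (.of_forall fun t => abs_nonneg _) hq.abs
  · exact hx.2

theorem norm_integral_mul_le {f k : ℝ → ℂ} {B K : ℝ} (hx : 0 ≤ x)
    (hB : ∀ t ∈ Set.Icc 0 x, ‖f t‖ ≤ B) (hK : ∀ t ∈ Set.Icc 0 x, ‖k t‖ ≤ K) :
    ‖∫ t in (0 : ℝ)..x, f t * k t‖ ≤ B * K * x := by
  have h := intervalIntegral.norm_integral_le_of_norm_le_const (a := 0) (b := x)
    (f := fun t => f t * k t) (C := B * K) fun t ht => by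
      rw [Set.uIoc_of_le hx] at ht
      have ht' := Set.Ioc_subset_Icc_self ht
      rw [norm_mul]
      exact mul_le_mul (hB t ht') (hK t ht') (norm_nonneg _) ((norm_nonneg _).trans (hB t ht'))
  rwa [sub_zero, abs_of_nonneg hx] at h

theorem continuousAt_integral_mul {u : ℂ → ℝ → ℂ} {k : ℝ → ℂ} {w : ℂ} {B : ℝ} (hx : 0 ≤ x)
    (hu : ∀ z, ContinuousOn (u z) (Set.Icc 0 x))
    (hB : ∀ᶠ z in nhds w, ∀ t ∈ Set.Icc 0 x, ‖u z t‖ ≤ B)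
    (hw : ∀ t ∈ Set.Icc 0 x, ContinuousAt (fun z => u z t) w)
    (hk : ContinuousOn k (Set.Icc 0 x)) :
    ContinuousAt (fun z => ∫ t in (0 : ℝ)..x, u z t * k t) w := by
  have hIoc : ∀ t ∈ Set.uIoc 0 x, t ∈ Set.Icc 0 x := fun t ht =>
    Set.Ioc_subset_Icc_self (by rwa [Set.uIoc_of_le hx] at ht)
  refine intervalIntegral.continuousAt_of_dominated_interval (bound := fun t => B * ‖k t‖)
    (.of_forall fun z => ?_) (hB.mono fun z hz => .of_forall fun t ht => ?_) ?_
    (.of_forall fun t ht => (hw t (hIoc t ht)).mul continuousAt_const)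
  · exact (((hu z).mul hk).mono hIoc).aestronglyMeasurable measurableSet_uIoc
  · rw [norm_mul]
    exact mul_le_mul_of_nonneg_right (hz t (hIoc t ht)) (norm_nonneg _)
  · rw [← Set.uIcc_of_le hx] at hk
    exact hk.intervalIntegrable.norm.const_mul _

theorem hasDerivAt_sub_mul_of_continuousAt {g : ℂ → ℂ} {w : ℂ} (hg : ContinuousAt g w) :
    HasDerivAt (fun z => (z - w) * g z) (g w) w := by
  rw [hasDerivAt_iff_tendsto_slope]
  refine (hg.tendsto.mono_left nhdsWithin_le_nhds).congr' ?_
  filter_upwards [self_mem_nhdsWithin] with z hz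
  rw [slope_def_field, sub_self, zero_mul, sub_zero, mul_div_cancel_left₀ _ (sub_ne_zero.2 hz)]

section Family

variable {u u1 u2 : ℂ → ℝ → ℂ} {p : Fin 3} {w : ℂ} {B : ℝ}

theorem continuousAt_isFundSol (hq : IntervalIntegrable q volume 0 l)
    (hu : ∀ z, IsFundSol q l p z (u z) (u1 z) (u2 z))
    (hB : ∀ᶠ z in nhds w, ∀ t ∈ Set.Icc 0 l, ‖u z t‖ ≤ B) (hx : x ∈ Set.Icc 0 l) :
    ContinuousAt (fun z => u z x) w := by
  obtain ⟨k, a0, a1, a2, hk, hf⟩ := exists_variation_of_constants hq hx w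
  obtain ⟨K, hK⟩ := isCompact_Icc.exists_bound_of_continuousOn hk
  have hdiff : ∀ z, u z x - u w x = -(I * (z - w)) * ∫ t in (0 : ℝ)..x, u z t * k t := by
    intro z
    rw [hf z _ _ _ (hu z).toIsSol, hf w _ _ _ (hu w).toIsSol, (hu z).init, (hu z).init1,
      (hu z).init2, (hu w).init, (hu w).init1, (hu w).init2]
    ring
  refine tendsto_iff_norm_sub_tendsto_zero.2 (squeeze_zero' (.of_forall fun z => norm_nonneg _)
    (g := fun z => ‖z - w‖ * (B * K * x)) ?_ ?_)
  · filter_upwards [hB] with z hz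
    rw [hdiff, norm_mul, norm_neg, norm_mul, norm_I, one_mul]
    gcongr
    exact norm_integral_mul_le hx.1 (fun t ht => hz t ⟨ht.1, ht.2.trans hx.2⟩) hK
  · have hcont : Continuous fun z => ‖z - w‖ * (B * K * x) := by fun_prop
    simpa using hcont.tendsto w

theorem differentiableAt_isFundSol (hq : IntervalIntegrable q volume 0 l)
    (hu : ∀ z, IsFundSol q l p z (u z) (u1 z) (u2 z))
    (hB : ∀ᶠ z in nhds w, ∀ t ∈ Set.Icc 0 l, ‖u z t‖ ≤ B) (hx : x ∈ Set.Icc 0 l) :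
    DifferentiableAt ℂ (fun z => u z x) w := by
  obtain ⟨k, a0, a1, a2, hk, hf⟩ := exists_variation_of_constants hq hx w
  have hIcc : Set.Icc 0 x ⊆ Set.Icc 0 l := Set.Icc_subset_Icc_right hx.2
  have h_int : ContinuousAt (fun z => ∫ t in (0 : ℝ)..x, u z t * k t) w :=
    continuousAt_integral_mul hx.1 (fun z => ((hu z).continuousOn (hx.1.trans hx.2)).mono hIcc)
      (hB.mono fun z hz t ht => hz t (hIcc ht))
      (fun t ht => continuousAt_isFundSol hq hu hB (hIcc ht)) hk
  refine (((hasDerivAt_sub_mul_of_continuousAt h_int).const_mul I).const_sub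
    (a0 * u w 0 + a1 * u1 w 0 + a2 * u2 w 0)).differentiableAt.congr_of_eventuallyEq
    (.of_forall fun z => ?_)
  simp only [hf z _ _ _ (hu z).toIsSol, (hu z).init, (hu z).init1, (hu z).init2, (hu w).init,
    (hu w).init1, (hu w).init2, mul_assoc]

end Family

theorem exists_eventually_norm_specSol_le (hl : 0 ≤ l) (hq : IntervalIntegrable q volume 0 l)
    (w : ℂ) :
    ∃ B, ∀ᶠ z in nhds w, ∀ p, ∀ x ∈ Set.Icc 0 l, ‖specSol q p z x‖ ≤ B := by
  refine ⟨(1 + l) ^ 2 * Real.exp ((1 + l) ^ 2 * ∫ t in (0 : ℝ)..l, |q t|)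
    * Real.exp ((‖w‖ + 1) ^ (1 / 3 : ℝ) * l), ?_⟩
  filter_upwards [Metric.ball_mem_nhds w one_pos] with z hz p x hx
  have hnorm : ‖z‖ ≤ ‖w‖ + 1 := by
    linarith [norm_sub_norm_le z w, mem_ball_iff_norm.1 hz]
  refine (norm_specSol_le hq p z hx).trans ?_
  gcongr

theorem differentiable_specSol (hq : IntervalIntegrable q volume 0 l) (p : Fin 3)
    (hx : x ∈ Set.Icc 0 l) : Differentiable ℂ (fun z => specSol q p z x) := fun w => by
  choose u1 u2 hu using exists_isFundSol_specSol (hx.1.trans hx.2) hq p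
  obtain ⟨B, hB⟩ := exists_eventually_norm_specSol_le (hx.1.trans hx.2) hq w
  exact differentiableAt_isFundSol hq hu (hB.mono fun z hz => hz p) hx

end FundamentalSolutions

section SpectralFunction

variable {q : ℝ → ℝ} {l : ℝ} {z w : ℂ} {u u1 u2 v v1 v2 : ℝ → ℂ}

theorem conj_coeff (q : ℝ → ℝ) (z : ℂ) (x : ℝ) :
    (starRingEnd ℂ) (coeff q z x) = I * ((starRingEnd ℂ) z - q x) := by
  simp [coeff]

theorem integral_mul_conj (u : ℝ → ℂ) (x : ℝ) :
    ∫ t in (0 : ℝ)..x, u t * (starRingEnd ℂ) (u t)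
      = ((∫ t in (0 : ℝ)..x, ‖u t‖ ^ 2 : ℝ) : ℂ) := by
  rw [← intervalIntegral.integral_ofReal]
  exact intervalIntegral.integral_congr fun t _ => by rw [mul_conj, normSq_eq_norm_sq]

theorem IsSol.lagrange_conj (hu : IsSol (coeff q z) l u u1 u2) (hv : IsSol (coeff q w) l v v1 v2)
    (hl : 0 ≤ l) :
    u2 l * (starRingEnd ℂ) (v l) - u1 l * (starRingEnd ℂ) (v1 l) + u l * (starRingEnd ℂ) (v2 l)
      = u2 0 * (starRingEnd ℂ) (v 0) - u1 0 * (starRingEnd ℂ) (v1 0)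
        + u 0 * (starRingEnd ℂ) (v2 0)
        - I * (z - (starRingEnd ℂ) w) * ∫ t in (0 : ℝ)..l, u t * (starRingEnd ℂ) (v t) := by
  rw [hu.lagrange (hv.map_conj hl) hl, sub_eq_add_neg _ (I * _ * _), ← neg_mul,
    ← intervalIntegral.integral_const_mul]
  congr 1
  refine intervalIntegral.integral_congr fun t _ => ?_
  simp only [conj_coeff]
  rw [coeff]
  ring

theorem eq_zero_of_integral_norm_sq_eq_zero (hl : 0 < l) (hu : ContinuousOn u (Set.Icc 0 l))
    (h : ∫ t in (0 : ℝ)..l, ‖u t‖ ^ 2 = 0) : ∀ x ∈ Set.Icc 0 l, u x = 0 := by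
  by_contra! hne
  obtain ⟨x, hx, hne⟩ := hne
  exact h.not_gt (intervalIntegral.integral_pos hl (by fun_prop) (fun t _ => by positivity)
    ⟨x, hx, by positivity⟩)

theorem IsSol.eq_zero_of_im_nonneg (hu : IsSol (coeff q z) l u u1 u2) (hl : 0 ≤ l)
    (hz : 0 ≤ z.im) (hu0 : u 0 = 0) (hu1 : u1 0 = 0) (hul : u l = 0) :
    ∀ x ∈ Set.Icc 0 l, u x = 0 := by
  have hc := hu.map_conj hl
  have hprim := hu.prim.mul hc.prim hl
  have hprim1 := (hu.prim1.mul hc.prim hl).add (hu.prim.mul hc.prim1 hl)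
  -- By Lagrange's identity `(|u|²)'' = 3 |u'|² + 2 Im z ∫_0^x |u|² ≥ 0`.
  have hconvex : ∀ x ∈ Set.Icc 0 l, 0 ≤ (u2 x * (starRingEnd ℂ) (u x)
      + u1 x * (starRingEnd ℂ) (u1 x) + (u1 x * (starRingEnd ℂ) (u1 x)
      + u x * (starRingEnd ℂ) (u2 x))).re := by
    intro x hx
    have hlagrange := (hu.mono hx).lagrange_conj (hu.mono hx) hx.1
    rw [hu0, hu1, map_zero, mul_zero, zero_mul, zero_mul, sub_conj, integral_mul_conj] at hlagrange
    have h_int : 0 ≤ ∫ t in (0 : ℝ)..x, ‖u t‖ ^ 2 :=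
      intervalIntegral.integral_nonneg hx.1 fun t _ => by positivity
    calc 0 ≤ 3 * normSq (u1 x) + 2 * z.im * ∫ t in (0 : ℝ)..x, ‖u t‖ ^ 2 := by
          have := normSq_nonneg (u1 x)
          positivity
      _ = (3 * (normSq (u1 x) : ℂ) + 2 * z.im * (∫ t in (0 : ℝ)..x, ‖u t‖ ^ 2 : ℝ)).re := by
          norm_cast
      _ = _ := congrArg re ?_
    rw [← mul_conj]
    push_cast at hlagrange
    linear_combination -hlagrange + 2 * z.im * (∫ t in (0 : ℝ)..x, ‖u t‖ ^ 2 : ℝ) * I_sq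
  have hmono1 := hprim1.re.monotoneOn hconvex
  have hmono := hprim.re.monotoneOn fun x hx => by
    simpa [hu0, hu1] using hmono1 ⟨le_rfl, hl⟩ hx hx.1
  intro x hx
  have hle := hmono hx ⟨hl, le_rfl⟩ hx.2
  simp only [mul_conj, ofReal_re, hul, map_zero, mul_zero, zero_re] at hle
  exact normSq_eq_zero.1 (hle.antisymm (normSq_nonneg _))

/-- The value `s_2(λ,l)` as a function of `z = λ³`. -/
def specEnd (q : ℝ → ℝ) (l : ℝ) (z : ℂ) : ℂ := specSol q 2 z l

/-- The characteristic function `Δ_θ(q,λ)` as a function of `z = λ³`. The Wronskian of `s_1` and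
`s_2` solves the adjoint equation, which turns it into the value `conj s_2(conj z, l)` used
here. -/
def specFun (q : ℝ → ℝ) (l : ℝ) (θ z : ℂ) : ℂ :=
  -((starRingEnd ℂ) (specEnd q l ((starRingEnd ℂ) z)) + θ * specEnd q l z)

theorem wronskian_end (hl : 0 ≤ l) (hq : IntervalIntegrable q volume 0 l)
    (hu : IsFundSol q l 1 z u u1 u2) (hv : IsFundSol q l 2 z v v1 v2) :
    v l * u1 l - u l * v1 l = -(starRingEnd ℂ) (specEnd q l ((starRingEnd ℂ) z)) := by
  have hW := ((hu.toIsSol.wronskian hv.toIsSol hl).map_conj hl).congr_coeff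
    (d := coeff q ((starRingEnd ℂ) z)) hl fun x _ => by rw [map_neg, conj_coeff, coeff]; ring
  obtain ⟨s1, s2, hs⟩ := exists_isFundSol_specSol hl hq 2 ((starRingEnd ℂ) z)
  have hW' : IsFundSol q l 2 ((starRingEnd ℂ) z) _ _ _ :=
    ⟨hW, by simp [hu.init, hv.init], by simp [hu.init, hv.init],
      by simp [hu.init1, hv.init1, hv.init2]⟩
  rw [specEnd, ← hW'.unique hs hq ⟨hl, le_rfl⟩, conj_conj]
  ring

theorem charFun_eq_specFun (hl : 0 < l) (hq : IntervalIntegrable q volume 0 l) (θ lam : ℂ) :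
    charFun q l θ lam = specFun q l θ (lam ^ 3) := by
  obtain ⟨u1, u2, hu⟩ := exists_isFundSol hl.le hq 1 lam
  obtain ⟨v1, v2, hv⟩ := exists_isFundSol hl.le hq 2 lam
  rw [charFun, hu.fundSolDerivEnd_eq hl, hv.fundSolDerivEnd_eq hl, wronskian_end hl.le hq hu hv,
    fundSol_eq_specSol hq 2 lam ⟨hl.le, le_rfl⟩, specFun, specEnd, specEnd]
  ring

theorem differentiable_specEnd (hl : 0 ≤ l) (hq : IntervalIntegrable q volume 0 l) :
    Differentiable ℂ (specEnd q l) :=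
  differentiable_specSol hq 2 ⟨hl, le_rfl⟩

theorem differentiable_specFun (hl : 0 ≤ l) (hq : IntervalIntegrable q volume 0 l) (θ : ℂ) :
    Differentiable ℂ (specFun q l θ) := by
  have hS := differentiable_specEnd hl hq
  have hconj : Differentiable ℂ fun z => (starRingEnd ℂ) (specEnd q l ((starRingEnd ℂ) z)) :=
    fun z => differentiableAt_conj_conj_iff.2 (hS _)
  exact (hconj.add (hS.const_mul θ)).neg

theorem specEnd_ne_zero_of_im_nonneg (hl : 0 < l) (hq : IntervalIntegrable q volume 0 l)
    (hz : 0 ≤ z.im) : specEnd q l z ≠ 0 := by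
  intro hzero
  obtain ⟨u1, u2, hu⟩ := exists_isFundSol_specSol hl.le hq 2 z
  have hu0 := hu.eq_zero_of_im_nonneg hl.le hz (by simp [hu.init]) (by simp [hu.init1])
    hzero
  have hinit2 := (hu.derivs_eq_zero hl hu0 ⟨le_rfl, hl.le⟩).2
  exact one_ne_zero (hu.init2.symm.trans hinit2)

/-- The solution `s_2(z,l) s_1(z,x) - s_1(z,l) s_2(z,x)`, which vanishes at both ends of
`[0, l]`; it is an eigenfunction when `z` is a zero of the characteristic function. -/
def dirichletSol (q : ℝ → ℝ) (l : ℝ) (z : ℂ) (x : ℝ) : ℂ :=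
  specEnd q l z * specSol q 1 z x + -specSol q 1 z l * specSol q 2 z x

theorem dirichletSol_right (q : ℝ → ℝ) (l : ℝ) (z : ℂ) : dirichletSol q l z l = 0 := by
  rw [dirichletSol, specEnd]
  ring

theorem exists_isSol_dirichletSol (hl : 0 ≤ l) (hq : IntervalIntegrable q volume 0 l) (z : ℂ) :
    ∃ y1 y2, IsSol (coeff q z) l (dirichletSol q l z) y1 y2 ∧ dirichletSol q l z 0 = 0 ∧
      y1 0 = specEnd q l z ∧ y1 l = -(starRingEnd ℂ) (specEnd q l ((starRingEnd ℂ) z)) := by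
  obtain ⟨u1, u2, hu⟩ := exists_isFundSol_specSol hl hq 1 z
  obtain ⟨v1, v2, hv⟩ := exists_isFundSol_specSol hl hq 2 z
  refine ⟨_, _, (hu.toIsSol.const_mul hl (specEnd q l z)).add
    (hv.toIsSol.const_mul hl (-specSol q 1 z l)) hl, ?_, ?_, ?_⟩
  · simp [dirichletSol, hu.init, hv.init]
  · simp [hu.init1, hv.init1]
  · rw [← wronskian_end hl hq hu hv, specEnd]
    ring

theorem continuousOn_dirichletSol (hl : 0 ≤ l) (hq : IntervalIntegrable q volume 0 l) (z : ℂ) :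
    ContinuousOn (dirichletSol q l z) (Set.Icc 0 l) := by
  obtain ⟨y1, y2, hy, -⟩ := exists_isSol_dirichletSol hl hq z
  exact hy.continuousOn hl

theorem green_dirichletSol (hl : 0 ≤ l) (hq : IntervalIntegrable q volume 0 l) (z w : ℂ) :
    (starRingEnd ℂ) (specEnd q l ((starRingEnd ℂ) z)) * specEnd q l ((starRingEnd ℂ) w)
      = specEnd q l z * (starRingEnd ℂ) (specEnd q l w) + I * (z - (starRingEnd ℂ) w)
        * ∫ t in (0 : ℝ)..l, dirichletSol q l z t * (starRingEnd ℂ) (dirichletSol q l w t) := by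
  obtain ⟨y1, y2, hy, hy0, hy10, hy1l⟩ := exists_isSol_dirichletSol hl hq z
  obtain ⟨x1, x2, hx, hx0, hx10, hx1l⟩ := exists_isSol_dirichletSol hl hq w
  have hlagrange := hy.lagrange_conj hx hl
  rw [hy0, hx0, hy10, hx10, hy1l, hx1l, dirichletSol_right, dirichletSol_right, map_neg,
    conj_conj, map_zero] at hlagrange
  linear_combination -hlagrange

theorem integral_norm_sq_dirichletSol_ne_zero (hl : 0 < l) (hq : IntervalIntegrable q volume 0 l)
    (hz : specEnd q l z ≠ 0) : ∫ t in (0 : ℝ)..l, ‖dirichletSol q l z t‖ ^ 2 ≠ 0 := by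
  obtain ⟨y1, y2, hy, -, hy10, -⟩ := exists_isSol_dirichletSol hl.le hq z
  intro h_int
  have hzero := eq_zero_of_integral_norm_sq_eq_zero hl (hy.continuousOn hl.le) h_int
  exact hz (hy10.symm.trans (hy.derivs_eq_zero hl hzero ⟨le_rfl, hl.le⟩).1)

theorem conj_specEnd_conj_of_specFun_eq_zero {θ : ℂ} (hz : specFun q l θ z = 0) :
    (starRingEnd ℂ) (specEnd q l ((starRingEnd ℂ) z)) = -(θ * specEnd q l z) := by
  rw [specFun, neg_eq_zero] at hz
  exact eq_neg_of_add_eq_zero_left hz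

theorem mul_conj_eq_one {θ : ℂ} (hθ : ‖θ‖ = 1) : θ * (starRingEnd ℂ) θ = 1 := by
  rw [mul_conj', hθ, ofReal_one, one_pow]

theorem specEnd_ne_zero_of_specFun_eq_zero (hl : 0 < l) (hq : IntervalIntegrable q volume 0 l)
    {θ : ℂ} (hz : specFun q l θ z = 0) : specEnd q l z ≠ 0 := by
  intro hzero
  have hconj := conj_specEnd_conj_of_specFun_eq_zero hz
  rw [hzero, mul_zero, neg_zero, map_eq_zero] at hconj
  rcases le_total 0 z.im with him | him
  · exact specEnd_ne_zero_of_im_nonneg hl hq him hzero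
  · exact specEnd_ne_zero_of_im_nonneg hl hq (by simpa using him) hconj

theorem im_eq_zero_of_specFun_eq_zero (hl : 0 < l) (hq : IntervalIntegrable q volume 0 l)
    {θ : ℂ} (hθ : ‖θ‖ = 1) (hz : specFun q l θ z = 0) : z.im = 0 := by
  have hconj := conj_specEnd_conj_of_specFun_eq_zero hz
  have hgreen := green_dirichletSol hl.le hq z z
  have hconj' : specEnd q l ((starRingEnd ℂ) z) = -((starRingEnd ℂ) θ * (starRingEnd ℂ)
      (specEnd q l z)) := by
    rw [← conj_conj (specEnd q l ((starRingEnd ℂ) z)), hconj, map_neg, map_mul]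
  rw [hconj, hconj', integral_mul_conj, sub_conj] at hgreen
  have hprod : ((2 * z.im : ℝ) : ℂ) * (∫ t in (0 : ℝ)..l, ‖dirichletSol q l z t‖ ^ 2 : ℝ) = 0 := by
    linear_combination hgreen - specEnd q l z * (starRingEnd ℂ) (specEnd q l z)
      * mul_conj_eq_one hθ
      + ((2 * z.im : ℝ) : ℂ) * (∫ t in (0 : ℝ)..l, ‖dirichletSol q l z t‖ ^ 2 : ℝ) * I_sq
  have hprod' := (mul_eq_zero.1 (by exact_mod_cast hprod)).resolve_right
    (integral_norm_sq_dirichletSol_ne_zero hl hq (specEnd_ne_zero_of_specFun_eq_zero hl hq hz))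
  linarith

theorem continuousAt_integral_dirichletSol_mul (hl : 0 ≤ l) (hq : IntervalIntegrable q volume 0 l)
    (w : ℂ) {k : ℝ → ℂ} (hk : ContinuousOn k (Set.Icc 0 l)) :
    ContinuousAt (fun z => ∫ t in (0 : ℝ)..l, dirichletSol q l z t * k t) w := by
  obtain ⟨B, hB⟩ := exists_eventually_norm_specSol_le hl hq w
  have hll : l ∈ Set.Icc 0 l := ⟨hl, le_rfl⟩
  refine continuousAt_integral_mul (B := B * B + B * B) hl (continuousOn_dirichletSol hl hq) ?_
    (fun t ht => ?_) hk
  · filter_upwards [hB] with z hz t ht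
    have hB0 : 0 ≤ B := (norm_nonneg _).trans (hz 1 l hll)
    refine (norm_add_le _ _).trans ?_
    rw [norm_mul, norm_mul, norm_neg]
    gcongr <;> apply_rules [hz]
  · exact (((differentiable_specEnd hl hq).mul (differentiable_specSol hq 1 ht)).add
      ((differentiable_specSol hq 1 hll).neg.mul
        (differentiable_specSol hq 2 ht))).continuous.continuousAt

theorem deriv_specFun_ne_zero (hl : 0 < l) (hq : IntervalIntegrable q volume 0 l) {θ : ℂ}
    (hθ : ‖θ‖ = 1) (hw : specFun q l θ w = 0) : deriv (specFun q l θ) w ≠ 0 := by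
  intro hderiv
  have hreal : (starRingEnd ℂ) w = w :=
    conj_eq_iff_im.2 (im_eq_zero_of_specFun_eq_zero hl hq hθ hw)
  have hconj := conj_specEnd_conj_of_specFun_eq_zero hw
  have hgreen : ∀ z, specFun q l θ z * (starRingEnd ℂ) (θ * specEnd q l w) = I * ((z - w)
      * ∫ t in (0 : ℝ)..l, dirichletSol q l z t * (starRingEnd ℂ) (dirichletSol q l w t)) := by
    intro z
    have hz := green_dirichletSol hl.le hq z w
    have hconj' : specEnd q l w = -(starRingEnd ℂ) (θ * specEnd q l w) := by
      rw [← map_neg, ← hconj, hreal, conj_conj]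
    rw [hreal] at hz
    rw [specFun]
    rw [map_mul] at hconj' ⊢
    linear_combination hz - (starRingEnd ℂ) (specEnd q l ((starRingEnd ℂ) z)) * hconj'
      - specEnd q l z * (starRingEnd ℂ) (specEnd q l w) * mul_conj_eq_one hθ
  have hcont := continuousAt_integral_dirichletSol_mul hl.le hq w
    (continuous_conj.comp_continuousOn (continuousOn_dirichletSol hl.le hq w))
  have hleft := (differentiable_specFun hl.le hq θ w).hasDerivAt.mul_const
    ((starRingEnd ℂ) (θ * specEnd q l w))
  rw [funext hgreen, hderiv, zero_mul] at hleft
  have hright := (hasDerivAt_sub_mul_of_continuousAt hcont).const_mul I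
  have h_int := (mul_eq_zero.1 (hright.unique hleft)).resolve_left I_ne_zero
  rw [Function.comp_def, integral_mul_conj] at h_int
  exact integral_norm_sq_dirichletSol_ne_zero hl hq (specEnd_ne_zero_of_specFun_eq_zero hl hq hw)
    (by exact_mod_cast h_int)

end SpectralFunction

section EntireFunctions

open Filter Topology Asymptotics

variable {f g : ℂ → ℂ}

theorem finite_zeros_norm_le (hf : Differentiable ℂ f) (h0 : f 0 ≠ 0) (R : ℝ) :
    {a : ℂ | f a = 0 ∧ ‖a‖ ≤ R}.Finite := by
  have hf' : AnalyticOnNhd ℂ f Set.univ := hf.differentiableOn.analyticOnNhd isOpen_univ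
  refine ((isCompact_closedBall (0 : ℂ) R).finite_sdiff_of_mem_codiscreteWithin
    (codiscreteWithin_mono (Set.subset_univ _)
      (hf'.preimage_zero_mem_codiscrete h0))).subset fun a ha => ?_
  simpa [and_comm] using ha

/-- The zeros of an entire function in the closed disc of radius `R` about the origin. -/
def zerosIn (hf : Differentiable ℂ f) (h0 : f 0 ≠ 0) (R : ℝ) : Finset ℂ :=
  (finite_zeros_norm_le hf h0 R).toFinset

theorem mem_zerosIn (hf : Differentiable ℂ f) (h0 : f 0 ≠ 0) {R : ℝ} {a : ℂ} :
    a ∈ zerosIn hf h0 R ↔ f a = 0 ∧ ‖a‖ ≤ R := by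
  simp [zerosIn]

theorem ne_zero_of_mem_zerosIn (hf : Differentiable ℂ f) (h0 : f 0 ≠ 0) {R : ℝ} {a : ℂ}
    (ha : a ∈ zerosIn hf h0 R) : a ≠ 0 := fun h =>
  h0 (h ▸ ((mem_zerosIn hf h0).1 ha).1)

theorem exists_eq_one_sub_div_mul (hf : Differentiable ℂ f) {a : ℂ} (ha : a ≠ 0) (hfa : f a = 0) :
    ∃ g, Differentiable ℂ g ∧ ∀ z, f z = (1 - z / a) * g z := by
  have hslope : Differentiable ℂ (dslope f a) := by
    rw [← differentiableOn_univ, differentiableOn_dslope univ_mem, differentiableOn_univ]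
    exact hf
  refine ⟨fun z => -a * dslope f a z, hslope.const_mul _, fun z => ?_⟩
  have hz : (z - a) * dslope f a z = f z := by
    simpa [hfa] using sub_smul_dslope f a z
  rw [← hz]
  field_simp
  ring

theorem exists_eq_prod_one_sub_div_mul (hf : Differentiable ℂ f) (S : Finset ℂ)
    (hS : ∀ a ∈ S, a ≠ 0 ∧ f a = 0) :
    ∃ g, Differentiable ℂ g ∧ ∀ z, f z = (∏ a ∈ S, (1 - z / a)) * g z := by
  classical
  induction S using Finset.induction_on with
  | empty => exact ⟨f, hf, fun z => by simp⟩
  | insert a S ha ih =>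
    rw [Finset.forall_mem_insert] at hS
    obtain ⟨g, hg, hfg⟩ := ih hS.2
    have hprod : ∏ b ∈ S, (1 - a / b) ≠ 0 := Finset.prod_ne_zero_iff.2 fun b hb hab => by
      rw [sub_eq_zero, eq_div_iff (hS.2 b hb).1, one_mul] at hab
      exact ha (hab ▸ hb)
    have hga : g a = 0 :=
      (mul_eq_zero.1 ((hfg a).symm.trans hS.1.2)).resolve_left hprod
    obtain ⟨k, hk, hgk⟩ := exists_eq_one_sub_div_mul hg hS.1.1 hga
    refine ⟨k, hk, fun z => ?_⟩
    rw [Finset.prod_insert ha, hfg, hgk]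
    ring

theorem ne_zero_of_eq_prod_one_sub_div_mul (hg : Differentiable ℂ g) {S : Finset ℂ}
    (hfg : ∀ z, f z = (∏ a ∈ S, (1 - z / a)) * g z) {w : ℂ} (hw : deriv f w ≠ 0) (hw0 : w ≠ 0)
    (hwS : w ∈ S) : g w ≠ 0 := by
  intro hgw
  have hprod : Differentiable ℂ fun z => ∏ a ∈ S, (1 - z / a) := by fun_prop
  have hprod0 : ∏ a ∈ S, (1 - w / a) = 0 := Finset.prod_eq_zero hwS (by simp [hw0])
  have hderiv := (hprod w).hasDerivAt.mul (hg w).hasDerivAt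
  rw [hgw, hprod0, mul_zero, zero_mul, add_zero] at hderiv
  exact hw ((funext hfg : f = _) ▸ hderiv.deriv)

theorem two_pow_card_mul_norm_le (hg : Differentiable ℂ g) {R A : ℝ} (hR : 0 < R)
    {S : Finset ℂ} (hS : ∀ a ∈ S, a ≠ 0 ∧ ‖a‖ ≤ R)
    (hfg : ∀ z, f z = (∏ a ∈ S, (1 - z / a)) * g z)
    (hA : ∀ z, ‖z‖ = 3 * R → ‖f z‖ ≤ A) {w : ℂ} (hw : ‖w‖ ≤ 3 * R) :
    2 ^ S.card * ‖g w‖ ≤ A := by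
  have hsphere : ∀ z ∈ frontier (Metric.ball (0 : ℂ) (3 * R)), ‖g z‖ ≤ A / 2 ^ S.card := by
    intro z hz
    rw [frontier_ball _ (by positivity), mem_sphere_zero_iff_norm] at hz
    have hprod : 2 ^ S.card ≤ ‖∏ a ∈ S, (1 - z / a)‖ := by
      rw [norm_prod, ← Finset.prod_const]
      refine Finset.prod_le_prod (fun _ _ => zero_le_two) fun a ha => ?_
      have hratio : 3 ≤ ‖z / a‖ := by
        rw [norm_div, hz, le_div_iff₀ (norm_pos_iff.2 (hS a ha).1)]
        linarith [(hS a ha).2]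
      have htriangle := norm_sub_norm_le (z / a) 1
      rw [norm_one, norm_sub_rev] at htriangle
      linarith
    rw [le_div_iff₀' (by positivity)]
    calc 2 ^ S.card * ‖g z‖ ≤ ‖∏ a ∈ S, (1 - z / a)‖ * ‖g z‖ := by gcongr
      _ = ‖f z‖ := by rw [hfg, norm_mul]
      _ ≤ A := hA z hz
  have hmax := norm_le_of_forall_mem_frontier_norm_le Metric.isBounded_ball hg.diffContOnCl hsphere
    (z := w) (by rwa [closure_ball _ (by positivity), mem_closedBall_zero_iff])
  rwa [le_div_iff₀' (by positivity)] at hmax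

theorem exists_eqOn_mul_exp {c : ℂ} {R : ℝ} (hR : 0 < R)
    (hg : DifferentiableOn ℂ g (Metric.ball c R)) (hne : ∀ z ∈ Metric.ball c R, g z ≠ 0) :
    ∃ h : ℂ → ℂ, DifferentiableOn ℂ h (Metric.ball c R) ∧ h c = 0 ∧
      ∀ z ∈ Metric.ball c R, g z = g c * exp (h z) := by
  have hlog : DifferentiableOn ℂ (logDeriv g) (Metric.ball c R) :=
    (hg.deriv Metric.isOpen_ball).div hg hne
  obtain ⟨h, hc, hh⟩ := hlog.isExactOn_ball.with_val_at c 0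
  have hdiff : DifferentiableOn ℂ h (Metric.ball c R) := fun z hz =>
    (hh z hz).differentiableAt.differentiableWithinAt
  have hlogDeriv : Set.EqOn (logDeriv g) (logDeriv fun z => exp (h z)) (Metric.ball c R) :=
    fun z hz => by
      rw [logDeriv_apply (fun z => exp (h z)), (hh z hz).cexp.deriv,
        mul_div_cancel_left₀ _ (exp_ne_zero _)]
  obtain ⟨k, -, hk⟩ := (logDeriv_eqOn_iff hg hdiff.cexp Metric.isOpen_ball
    (convex_ball c R).isPreconnected (fun z _ => exp_ne_zero _) hne).1 hlogDeriv
  have hkc : g c = k := by simpa [hc] using hk (Metric.mem_ball_self hR)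
  exact ⟨h, hdiff, hc, fun z hz => by simpa [hkc] using hk hz⟩

theorem exists_eq_mul_exp_norm_le {R M : ℝ} (hM : 0 < M)
    (hg : DifferentiableOn ℂ g (Metric.ball 0 R)) (hne : ∀ z ∈ Metric.ball 0 R, g z ≠ 0)
    (hbound : ∀ z ∈ Metric.ball 0 R, ‖g z‖ ≤ ‖g 0‖ * Real.exp M) {z : ℂ} (hz : ‖z‖ < R) :
    ∃ h : ℂ, g z = g 0 * exp h ∧ ‖h‖ ≤ 2 * M * ‖z‖ / (R - ‖z‖) := by
  have hR : 0 < R := (norm_nonneg z).trans_lt hz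
  obtain ⟨h, hdiff, h0, hexp⟩ := exists_eqOn_mul_exp hR hg hne
  have hg0 : 0 < ‖g 0‖ := norm_pos_iff.2 (hne 0 (Metric.mem_ball_self hR))
  refine ⟨h z, hexp z (mem_ball_zero_iff.2 hz), ?_⟩
  refine borelCaratheodory_zero hM hdiff (fun w hw => ?_) hR (mem_ball_zero_iff.2 hz) h0
  have hw' := hbound w hw
  rw [hexp w hw, norm_mul, norm_exp, mul_le_mul_iff_right₀ hg0] at hw'
  exact Real.exp_le_exp.1 hw'

theorem exists_eq_prod_zerosIn_mul (hf : Differentiable ℂ f) (h0 : f 0 ≠ 0) (R : ℝ) :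
    ∃ g, Differentiable ℂ g ∧ g 0 = f 0 ∧
      ∀ z, f z = (∏ a ∈ zerosIn hf h0 R, (1 - z / a)) * g z := by
  obtain ⟨g, hg, hfg⟩ := exists_eq_prod_one_sub_div_mul hf (zerosIn hf h0 R) fun a ha =>
    ⟨ne_zero_of_mem_zerosIn hf h0 ha, ((mem_zerosIn hf h0).1 ha).1⟩
  exact ⟨g, hg, by simp [hfg 0], hfg⟩

theorem card_zerosIn_mul_log_two_le (hf : Differentiable ℂ f) (h0 : f 0 ≠ 0) {R M : ℝ} (hR : 0 < R)
    (hM : ∀ z, ‖z‖ = 3 * R → ‖f z‖ ≤ ‖f 0‖ * Real.exp M) :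
    (zerosIn hf h0 R).card * Real.log 2 ≤ M := by
  obtain ⟨g, hg, hg0, hfg⟩ := exists_eq_prod_zerosIn_mul hf h0 R
  have hcard := two_pow_card_mul_norm_le hg hR
    (fun a ha => ⟨ne_zero_of_mem_zerosIn hf h0 ha, ((mem_zerosIn hf h0).1 ha).2⟩) hfg hM
    (w := 0) (by simpa using hR.le)
  rw [hg0, mul_comm, mul_le_mul_iff_right₀ (norm_pos_iff.2 h0)] at hcard
  rw [← Real.log_pow]
  exact (Real.log_le_iff_le_exp (by positivity)).2 hcard

theorem exists_eq_prod_zerosIn_mul_exp (hf : Differentiable ℂ f) (h0 : f 0 ≠ 0)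
    (hsimple : ∀ w, f w = 0 → deriv f w ≠ 0) {R M : ℝ} (hM0 : 0 < M)
    (hM : ∀ z, ‖z‖ = 3 * R → ‖f z‖ ≤ ‖f 0‖ * Real.exp M) {z : ℂ} (hz : ‖z‖ < R) :
    ∃ h : ℂ, f z = f 0 * (∏ a ∈ zerosIn hf h0 R, (1 - z / a)) * exp h ∧
      ‖h‖ ≤ 2 * M * ‖z‖ / (R - ‖z‖) := by
  have hR : 0 < R := (norm_nonneg z).trans_lt hz
  obtain ⟨g, hg, hg0, hfg⟩ := exists_eq_prod_zerosIn_mul hf h0 R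
  have hne : ∀ w ∈ Metric.ball 0 R, g w ≠ 0 := by
    intro w hw hgw
    have hfw : f w = 0 := by rw [hfg, hgw, mul_zero]
    have hwmem := (mem_zerosIn hf h0).2 ⟨hfw, (mem_ball_zero_iff.1 hw).le⟩
    exact ne_zero_of_eq_prod_one_sub_div_mul hg hfg (hsimple w hfw)
      (ne_zero_of_mem_zerosIn hf h0 hwmem) hwmem hgw
  have hbound : ∀ w ∈ Metric.ball 0 R, ‖g w‖ ≤ ‖g 0‖ * Real.exp M := by
    intro w hw
    rw [hg0]
    refine (le_mul_of_one_le_left (norm_nonneg _) (one_le_pow₀ one_le_two)).trans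
      (two_pow_card_mul_norm_le hg hR
        (fun a ha => ⟨ne_zero_of_mem_zerosIn hf h0 ha, ((mem_zerosIn hf h0).1 ha).2⟩) hfg hM ?_)
    linarith [mem_ball_zero_iff.1 hw]
  obtain ⟨h, hgh, hh⟩ := exists_eq_mul_exp_norm_le hM0 hg.differentiableOn hne hbound hz
  exact ⟨h, by rw [hfg, hgh, hg0]; ring, hh⟩

theorem tendsto_mul_div_sub_of_isLittleO {M : ℝ → ℝ} (hM : M =o[atTop] id) (r : ℝ) :
    Tendsto (fun R => 2 * M R * r / (R - r)) atTop (𝓝 0) := by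
  have hsub : (id : ℝ → ℝ) =O[atTop] fun R => R - r :=
    ((isLittleO_const_id_atTop r).right_isBigO_sub).trans (isBigO_refl _ _)
  simpa [mul_right_comm] using ((hM.trans_isBigO hsub).const_mul_left (2 * r)).tendsto_div_nhds_zero

theorem tendsto_prod_zerosIn (hf : Differentiable ℂ f) (h0 : f 0 ≠ 0)
    (hsimple : ∀ w, f w = 0 → deriv f w ≠ 0) {m : ℝ → ℝ} (hm : m =o[atTop] id)
    (hfm : ∀ z, ‖f z‖ ≤ ‖f 0‖ * Real.exp (m ‖z‖)) (z : ℂ) :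
    Tendsto (fun R => ∏ a ∈ zerosIn hf h0 R, (1 - z / a)) atTop (𝓝 (f z / f 0)) := by
  set M : ℝ → ℝ := fun R => |m (3 * R)| + 1
  have hM : M =o[atTop] id := by
    have hscale : (fun R => m (3 * R)) =o[atTop] fun R : ℝ => 3 * R :=
      hm.comp_tendsto (tendsto_id.const_mul_atTop three_pos)
    exact (hscale.trans_isBigO (isBigO_const_mul_self _ _ _)).norm_left.add
      (isLittleO_const_id_atTop 1)
  have hfactor : ∀ R, ∃ h : ℂ, ‖z‖ < R →
      f z = f 0 * (∏ a ∈ zerosIn hf h0 R, (1 - z / a)) * exp h ∧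
        ‖h‖ ≤ 2 * M R * ‖z‖ / (R - ‖z‖) := by
    intro R
    by_cases hz : ‖z‖ < R
    · obtain ⟨h, hh⟩ := exists_eq_prod_zerosIn_mul_exp hf h0 hsimple (M := M R) (by positivity)
        (fun w hw => (hfm w).trans (by rw [hw]; gcongr; linarith [le_abs_self (m (3 * R))])) hz
      exact ⟨h, fun _ => hh⟩
    · exact ⟨0, fun h => absurd h hz⟩
  choose h hh using hfactor
  have hh0 : Tendsto h atTop (𝓝 0) :=
    squeeze_zero_norm' ((eventually_gt_atTop ‖z‖).mono fun R hR => (hh R hR).2)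
      (tendsto_mul_div_sub_of_isLittleO hM ‖z‖)
  have hlim : Tendsto (fun R => f z / f 0 * exp (-h R)) atTop (𝓝 (f z / f 0)) := by
    simpa using (hh0.neg.cexp).const_mul (f z / f 0)
  refine hlim.congr' ((eventually_gt_atTop ‖z‖).mono fun R hR => ?_)
  beta_reduce
  rw [(hh R hR).1, exp_neg]
  field_simp [exp_ne_zero]

theorem eq_mul_tprod_of_range_eq_zeros (hf : Differentiable ℂ f) (h0 : f 0 ≠ 0)
    (hsimple : ∀ w, f w = 0 → deriv f w ≠ 0) {m : ℝ → ℝ} (hm : m =o[atTop] id)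
    (hfm : ∀ z, ‖f z‖ ≤ ‖f 0‖ * Real.exp (m ‖z‖)) {ι : Type*} {a : ι → ℂ}
    (ha : Function.Injective a) (hrange : Set.range a = {w | f w = 0}) {z : ℂ}
    (hmul : Multipliable fun i => 1 - z / a i) : f z = f 0 * ∏' i, (1 - z / a i) := by
  classical
  have hzero : ∀ i, f (a i) = 0 := fun i => hrange.subset ⟨i, rfl⟩
  set T : ℝ → Finset ι := fun R => (zerosIn hf h0 R).preimage a ha.injOn
  have hT : Tendsto T atTop atTop := by
    refine tendsto_atTop_finset_of_monotone (fun R R' hRR' i hi => ?_) fun i =>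
      ⟨‖a i‖, by simp [T, mem_zerosIn, hzero]⟩
    simp only [T, Finset.mem_preimage, mem_zerosIn] at hi ⊢
    exact ⟨hi.1, hi.2.trans hRR'⟩
  have hprod : ∀ R, ∏ i ∈ T R, (1 - z / a i) = ∏ b ∈ zerosIn hf h0 R, (1 - z / b) := fun R =>
    Finset.prod_preimage a _ ha.injOn (fun b => 1 - z / b) fun b hb hbr =>
      absurd (hrange ▸ ((mem_zerosIn hf h0).1 hb).1 : b ∈ Set.range a) hbr
  have hlim := tendsto_nhds_unique
    ((hmul.hasProd.comp hT).congr hprod) (tendsto_prod_zerosIn hf h0 hsimple hm hfm z)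
  rw [hlim, mul_div_cancel₀ _ h0]

theorem norm_le_pow_card_mul_norm (hf : Differentiable ℂ f) (h0 : f 0 ≠ 0)
    (hsimple : ∀ w, f w = 0 → deriv f w ≠ 0) {m : ℝ → ℝ} (hm : m =o[atTop] id)
    (hfm : ∀ z, ‖f z‖ ≤ ‖f 0‖ * Real.exp (m ‖z‖)) {K : ℝ} (hK : 1 ≤ K) {P : Finset ℂ} {z w : ℂ}
    (hP : ∀ a, f a = 0 → a ∈ P → ‖1 - z / a‖ ≤ K * ‖1 - w / a‖)
    (hnP : ∀ a, f a = 0 → a ∉ P → ‖1 - z / a‖ ≤ ‖1 - w / a‖) :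
    ‖f z‖ ≤ K ^ P.card * ‖f w‖ := by
  classical
  have hprod : ∀ R, ‖∏ a ∈ zerosIn hf h0 R, (1 - z / a)‖
      ≤ K ^ P.card * ‖∏ a ∈ zerosIn hf h0 R, (1 - w / a)‖ := by
    intro R
    have hterm : ∀ a ∈ zerosIn hf h0 R,
        ‖1 - z / a‖ ≤ (if a ∈ P then K else 1) * ‖1 - w / a‖ := by
      intro a ha
      have hfa := ((mem_zerosIn hf h0).1 ha).1
      split_ifs with haP
      · exact hP a hfa haP
      · simpa using hnP a hfa haP
    rw [norm_prod, norm_prod]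
    refine (Finset.prod_le_prod (fun _ _ => norm_nonneg _) hterm).trans ?_
    rw [Finset.prod_mul_distrib, Finset.prod_ite, Finset.prod_const, Finset.prod_const_one, mul_one]
    gcongr
    exact fun a ha => (Finset.mem_filter.1 ha).2
  have hle := le_of_tendsto_of_tendsto' (tendsto_prod_zerosIn hf h0 hsimple hm hfm z).norm
    ((tendsto_prod_zerosIn hf h0 hsimple hm hfm w).norm.const_mul (K ^ P.card)) hprod
  rwa [norm_div, norm_div, ← mul_div_assoc,
    div_le_div_iff_of_pos_right (norm_pos_iff.2 h0)] at hle

theorem norm_one_sub_div_le_three_mul {z w a : ℂ} (hzw : ‖z‖ ≤ ‖w‖) (ha0 : a ≠ 0)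
    (ha : 2 * ‖a‖ ≤ ‖w‖) : ‖1 - z / a‖ ≤ 3 * ‖1 - w / a‖ := by
  have hw : 2 ≤ ‖w / a‖ := by rwa [norm_div, le_div_iff₀ (norm_pos_iff.2 ha0)]
  have hz : ‖z / a‖ ≤ ‖w / a‖ := by
    rw [norm_div, norm_div]
    gcongr
  have hupper := norm_sub_le 1 (z / a)
  have hlower := norm_sub_norm_le (w / a) 1
  rw [norm_sub_rev] at hlower
  rw [norm_one] at hupper hlower
  linarith

theorem norm_one_sub_div_ofReal_le {z : ℂ} {s b : ℝ} (hz : ‖z‖ ≤ |s|) (hsb : s * b ≤ 0) :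
    ‖1 - z / b‖ ≤ ‖1 - (s : ℂ) / b‖ := by
  have hs : s / b ≤ 0 := div_nonpos_iff.2 (mul_nonpos_iff.1 hsb)
  calc ‖1 - z / b‖ ≤ 1 + ‖z‖ / |b| := by
        simpa using norm_sub_le 1 (z / (b : ℂ))
    _ ≤ 1 + |s| / |b| := by gcongr
    _ = |1 - s / b| := by rw [← abs_div, abs_of_nonpos hs, abs_of_pos] <;> linarith
    _ = ‖1 - (s : ℂ) / b‖ := by
      rw [← ofReal_div, ← ofReal_one, ← ofReal_sub, norm_real, Real.norm_eq_abs]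

theorem exists_real_zero_gt (hf : Differentiable ℂ f) (h0 : f 0 ≠ 0)
    (hsimple : ∀ w, f w = 0 → deriv f w ≠ 0) (hreal : ∀ w, f w = 0 → w.im = 0) {m : ℝ → ℝ}
    (hm : m =o[atTop] id) (hfm : ∀ z, ‖f z‖ ≤ ‖f 0‖ * Real.exp (m ‖z‖)) {σ : ℝ} (hσ : |σ| = 1)
    (hgrow : ∀ K : ℝ, ∃ᶠ y : ℝ in atTop, K * ‖f (σ * y : ℝ)‖ < ‖f (I * y)‖) (R : ℝ) :
    ∃ b : ℝ, f b = 0 ∧ R < σ * b := by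
  by_contra! hle
  set P := zerosIn hf h0 |R|
  obtain ⟨y, hlt, hy⟩ := ((hgrow (3 ^ P.card)).and_eventually
    (eventually_ge_atTop (2 * |R|))).exists
  have hy0 : 0 ≤ y := by linarith [abs_nonneg R]
  have hσy : |σ * y| = y := by rw [abs_mul, hσ, one_mul, abs_of_nonneg hy0]
  have hIy : ‖I * (y : ℂ)‖ = |σ * y| := by
    rw [hσy, norm_mul, norm_I, one_mul, norm_real, Real.norm_of_nonneg hy0]
  refine hlt.not_ge (norm_le_pow_card_mul_norm hf h0 hsimple hm hfm (by norm_num)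
    (fun a _ haP => ?_) fun a ha haP => ?_)
  · refine norm_one_sub_div_le_three_mul (by rw [hIy, norm_real, Real.norm_eq_abs])
      (ne_zero_of_mem_zerosIn hf h0 haP) ?_
    rw [norm_real, Real.norm_eq_abs, hσy]
    linarith [((mem_zerosIn hf h0).1 haP).2]
  · obtain ⟨b, rfl⟩ : ∃ b : ℝ, (b : ℂ) = a :=
      ⟨a.re, Complex.ext rfl (hreal a ha).symm⟩
    refine norm_one_sub_div_ofReal_le hIy.le ?_
    have hb : σ * b ≤ 0 := by
      by_contra! hpos
      refine haP ((mem_zerosIn hf h0).2 ⟨ha, ?_⟩)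
      rw [norm_real, Real.norm_eq_abs, ← one_mul |b|, ← hσ, ← abs_mul, abs_of_pos hpos]
      exact (hle b ha).trans (le_abs_self R)
    nlinarith

end EntireFunctions

section Enumeration

open Filter Asymptotics

variable {S : Set ℝ} {μ : ℤ → ℝ}

theorem exists_isLeast_nonneg (hfin : ∀ R, (S ∩ Set.Icc (-R) R).Finite)
    (hne : ∃ x ∈ S, 0 ≤ x) : ∃ m, IsLeast {x | x ∈ S ∧ 0 ≤ x} m := by
  obtain ⟨r, hrS, hr⟩ := hne
  have hsub : (S ∩ Set.Icc 0 r).Finite :=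
    (hfin r).subset fun x hx => ⟨hx.1, by linarith [hx.2.1], hx.2.2⟩
  obtain ⟨m, hm, hmin⟩ := Set.exists_min_image _ id hsub ⟨r, hrS, hr, le_rfl⟩
  refine ⟨m, ⟨hm.1, hm.2.1⟩, fun x hx => ?_⟩
  rcases le_total x r with hxr | hrx
  · exact hmin x ⟨hx.1, hx.2, hxr⟩
  · exact hm.2.2.trans hrx

theorem nonempty_orderIso_int (hfin : ∀ R, (S ∩ Set.Icc (-R) R).Finite)
    (hup : ∀ R, ∃ x ∈ S, R < x) (hdown : ∀ R, ∃ x ∈ S, x < R) : Nonempty (S ≃o ℤ) := by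
  have hIcc : ∀ a b : S, (Set.Icc a b).Finite := by
    intro a b
    refine Set.Finite.of_finite_image (f := Subtype.val) ?_ Subtype.val_injective.injOn
    refine (hfin (max |(a : ℝ)| |(b : ℝ)|)).subset ?_
    rintro _ ⟨c, ⟨hac, hcb⟩, rfl⟩
    exact ⟨c.2, abs_le.1 (abs_le_max_abs_abs hac hcb)⟩
  let _ : LocallyFiniteOrder S := LocallyFiniteOrder.ofFiniteIcc hIcc
  let _ : SuccOrder S := LinearLocallyFiniteOrder.succOrder S
  let _ : PredOrder S := LinearLocallyFiniteOrder.predOrder S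
  have : NoMaxOrder S := ⟨fun a => let ⟨x, hx, hax⟩ := hup a; ⟨⟨x, hx⟩, hax⟩⟩
  have : NoMinOrder S := ⟨fun a => let ⟨x, hx, hxa⟩ := hdown a; ⟨⟨x, hx⟩, hxa⟩⟩
  have : Nonempty S := let ⟨x, hx, _⟩ := hup 0; ⟨⟨x, hx⟩⟩
  exact ⟨orderIsoIntOfLinearSuccPredArch⟩

theorem exists_isAscendingEnumeration (hfin : ∀ R, (S ∩ Set.Icc (-R) R).Finite)
    (hup : ∀ R, ∃ x ∈ S, R < x) (hdown : ∀ R, ∃ x ∈ S, x < R) :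
    ∃ μ, IsAscendingEnumeration S μ := by
  obtain ⟨e⟩ := nonempty_orderIso_int hfin hup hdown
  obtain ⟨m, hm⟩ := exists_isLeast_nonneg hfin ((hup 0).imp fun _ h => h.imp_right le_of_lt)
  refine ⟨fun n => (e.symm (n + e ⟨m, hm.1.1⟩) : S), ⟨fun a b hab => ?_, ?_, by simpa using hm⟩⟩
  · exact e.symm.strictMono (by simpa using hab)
  · refine Set.Subset.antisymm (Set.range_subset_iff.2 fun n => Subtype.coe_prop _) fun x hx => ?_
    exact ⟨e ⟨x, hx⟩ - e ⟨m, hm.1.1⟩, by simp⟩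

namespace IsAscendingEnumeration

theorem mem (hμ : IsAscendingEnumeration S μ) (n : ℤ) : μ n ∈ S :=
  hμ.range_eq ▸ Set.mem_range_self n

theorem neg_of_neg (hμ : IsAscendingEnumeration S μ) {n : ℤ} (hn : n < 0) : μ n < 0 := by
  by_contra! h
  exact (hμ.strictMono hn).not_ge (hμ.isLeast_zero.2 ⟨hμ.mem n, h⟩)

theorem image_orderIso (hμ : IsAscendingEnumeration S μ) {φ : ℝ ≃o ℝ} (hφ : φ 0 = 0) :
    IsAscendingEnumeration (φ '' S) (φ ∘ μ) := by
  have hnonneg : ∀ x, 0 ≤ φ x ↔ 0 ≤ x := fun x => by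
    simpa only [hφ] using φ.le_iff_le (x := 0) (y := x)
  refine ⟨φ.strictMono.comp hμ.strictMono, by rw [Set.range_comp, hμ.range_eq], ?_, ?_⟩
  · exact ⟨⟨_, hμ.mem 0, rfl⟩, (hnonneg _).2 hμ.isLeast_zero.1.2⟩
  · rintro _ ⟨⟨x, hx, rfl⟩, hx0⟩
    exact φ.monotone (hμ.isLeast_zero.2 ⟨hx, (hnonneg x).1 hx0⟩)

theorem exists_card_eq_natAbs (hμ : IsAscendingEnumeration S μ) (n : ℤ) :
    ∃ T : Finset ℤ, T.card = n.natAbs ∧ ∀ k ∈ T, |μ k| ≤ |μ n| := by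
  rcases le_or_gt 0 n with hn | hn
  · refine ⟨Finset.Ico 0 n, by rw [Int.card_Ico]; omega, fun k hk => ?_⟩
    rw [Finset.mem_Ico] at hk
    have hk0 := hμ.isLeast_zero.1.2.trans (hμ.strictMono.monotone hk.1)
    exact abs_le_abs_of_nonneg hk0 (hμ.strictMono hk.2).le
  · refine ⟨Finset.Ico n 0, by rw [Int.card_Ico]; omega, fun k hk => ?_⟩
    rw [Finset.mem_Ico] at hk
    exact abs_le_abs_of_nonpos (hμ.neg_of_neg hk.2).le (hμ.strictMono.monotone hk.1)

end IsAscendingEnumeration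

theorem summable_inv_of_abs_le_rpow {a : ℤ → ℝ} {ρ c : ℝ} (hρ0 : 0 < ρ) (hρ1 : ρ < 1)
    (h : ∀ n : ℤ, |(n : ℝ)| ≤ c * (1 + |a n| ^ ρ)) : Summable fun n => |a n|⁻¹ := by
  have hle : ∀ᶠ n : ℤ in cofinite, ‖|a n|⁻¹‖ ≤ (2 * |c|) ^ ρ⁻¹ * ‖|(n : ℝ)| ^ (-ρ⁻¹)‖ := by
    have hlarge := (tendsto_norm_cocompact_atTop.comp Int.tendsto_coe_cofinite).eventually_gt_atTop
      (2 * |c|)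
    filter_upwards [hlarge] with n hn
    rw [Function.comp_apply, Real.norm_eq_abs] at hn
    have hmain : |(n : ℝ)| ≤ 2 * |c| * |a n| ^ ρ := by
      have hc : c * (1 + |a n| ^ ρ) ≤ |c| * (1 + |a n| ^ ρ) := by gcongr; exact le_abs_self c
      linarith [h n]
    have hn0 : 0 < |(n : ℝ)| ^ ρ⁻¹ := Real.rpow_pos_of_pos (by linarith [abs_nonneg c]) _
    have hroot : |(n : ℝ)| ^ ρ⁻¹ ≤ (2 * |c|) ^ ρ⁻¹ * |a n| := by
      refine (Real.rpow_le_rpow (abs_nonneg _) hmain (inv_nonneg.2 hρ0.le)).trans_eq ?_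
      rw [Real.mul_rpow (by positivity) (by positivity), Real.rpow_rpow_inv (abs_nonneg _) hρ0.ne']
    have han : 0 < |a n| := pos_of_mul_pos_right (hn0.trans_le hroot) (by positivity)
    rw [Real.rpow_neg (abs_nonneg _), norm_inv, norm_inv, Real.norm_of_nonneg hn0.le,
      Real.norm_of_nonneg han.le, ← div_eq_mul_inv, le_div_iff₀ hn0, inv_mul_le_iff₀ han, mul_comm]
    exact hroot
  exact summable_of_isBigO (Real.summable_abs_int_rpow (one_lt_inv₀ hρ0 |>.2 hρ1))
    (IsBigO.of_bound _ hle)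

end Enumeration

section Hadamard

open Filter Topology Asymptotics

variable {f : ℂ → ℂ} {ν : ℤ → ℝ} {B τ ρ : ℝ}

theorem isLittleO_const_add_mul_rpow (hρ : ρ < 1) :
    (fun r : ℝ => B + τ * r ^ ρ) =o[atTop] (id : ℝ → ℝ) := by
  have hrpow : (fun r : ℝ => r ^ ρ) =o[atTop] (id : ℝ → ℝ) := by
    refine isLittleO_of_tendsto' ((eventually_ne_atTop 0).mono fun r hr h => absurd h hr) ?_
    refine (tendsto_rpow_neg_atTop (sub_pos.2 hρ)).congr' ?_
    filter_upwards [eventually_gt_atTop 0] with r hr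
    rw [neg_sub, Real.rpow_sub_one hr.ne', id]
  exact (isLittleO_const_id_atTop B).add (hrpow.const_mul_left τ)

theorem exists_isAscendingEnumeration_zeros (hf : Differentiable ℂ f) (h0 : f 0 ≠ 0)
    (hsimple : ∀ w, f w = 0 → deriv f w ≠ 0) (hreal : ∀ w, f w = 0 → w.im = 0) {m : ℝ → ℝ}
    (hm : m =o[atTop] id) (hfm : ∀ z, ‖f z‖ ≤ ‖f 0‖ * Real.exp (m ‖z‖))
    (hgrow : ∀ σ : ℝ, |σ| = 1 → ∀ K : ℝ, ∃ᶠ y : ℝ in atTop, K * ‖f (σ * y : ℝ)‖ < ‖f (I * y)‖) :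
    ∃ ν, IsAscendingEnumeration {b : ℝ | f b = 0} ν := by
  have hbeyond : ∀ σ : ℝ, |σ| = 1 → ∀ R, ∃ b : ℝ, f b = 0 ∧ R < σ * b := fun σ hσ =>
    exists_real_zero_gt hf h0 hsimple hreal hm hfm hσ (hgrow σ hσ)
  refine exists_isAscendingEnumeration (fun R => ?_) (fun R => ?_) fun R => ?_
  · refine Set.Finite.of_finite_image (f := ((↑) : ℝ → ℂ)) ?_ ofReal_injective.injOn
    refine (finite_zeros_norm_le hf h0 R).subset ?_
    rintro _ ⟨b, ⟨hb, hbR⟩, rfl⟩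
    exact ⟨hb, by rw [norm_real]; exact abs_le.2 hbR⟩
  · simpa using hbeyond 1 abs_one R
  · obtain ⟨b, hb, hRb⟩ := hbeyond (-1) (by norm_num) (-R)
    exact ⟨b, hb, by linarith⟩

theorem natAbs_mul_log_two_le (hf : Differentiable ℂ f) (h0 : f 0 ≠ 0)
    (hν : IsAscendingEnumeration {b : ℝ | f b = 0} ν) {m : ℝ → ℝ}
    (hfm : ∀ z, ‖f z‖ ≤ ‖f 0‖ * Real.exp (m ‖z‖)) (n : ℤ) :
    n.natAbs * Real.log 2 ≤ m (3 * |ν n|) := by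
  classical
  have hνn : 0 < |ν n| := abs_pos.2 fun h => h0 (by simpa [h] using hν.mem n)
  obtain ⟨T, hT, hTn⟩ := hν.exists_card_eq_natAbs n
  have hcard : n.natAbs ≤ (zerosIn hf h0 |ν n|).card := by
    rw [← hT, ← Finset.card_image_of_injective T (ofReal_injective.comp hν.strictMono.injective)]
    refine Finset.card_le_card fun a ha => ?_
    obtain ⟨k, hk, rfl⟩ := Finset.mem_image.1 ha
    exact (mem_zerosIn hf h0).2 ⟨hν.mem k, by simpa using hTn k hk⟩
  calc n.natAbs * Real.log 2 ≤ (zerosIn hf h0 |ν n|).card * Real.log 2 := by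
        gcongr
    _ ≤ m (3 * |ν n|) := card_zerosIn_mul_log_two_le hf h0 hνn fun z hz => hz ▸ hfm z

theorem summable_inv_zeros (hf : Differentiable ℂ f) (h0 : f 0 ≠ 0) (hρ0 : 0 < ρ) (hρ1 : ρ < 1)
    (hfm : ∀ z, ‖f z‖ ≤ ‖f 0‖ * Real.exp (B + τ * ‖z‖ ^ ρ))
    (hν : IsAscendingEnumeration {b : ℝ | f b = 0} ν) : Summable fun n => |ν n|⁻¹ := by
  have hlog : 0 < Real.log 2 := Real.log_pos one_lt_two
  refine summable_inv_of_abs_le_rpow (c := (|B| + |τ| * 3 ^ ρ) / Real.log 2) hρ0 hρ1 fun n => ?_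
  rw [div_mul_eq_mul_div, le_div_iff₀ hlog, ← Int.cast_abs, ← Nat.cast_natAbs]
  calc n.natAbs * Real.log 2 ≤ B + τ * (3 * |ν n|) ^ ρ :=
        natAbs_mul_log_two_le hf h0 hν (m := fun r => B + τ * r ^ ρ) hfm n
    _ ≤ |B| + |τ| * (3 * |ν n|) ^ ρ := by gcongr <;> exact le_abs_self _
    _ = |B| + |τ| * 3 ^ ρ * |ν n| ^ ρ := by
      rw [Real.mul_rpow zero_le_three (abs_nonneg _), mul_assoc]
    _ ≤ (|B| + |τ| * 3 ^ ρ) * (1 + |ν n| ^ ρ) := by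
      have hB : 0 ≤ |B| * |ν n| ^ ρ := by positivity
      have hτ : 0 ≤ |τ| * 3 ^ ρ := by positivity
      linarith

theorem multipliable_one_sub_div_ofReal {ι : Type*} {a : ι → ℝ} (ha : Summable fun i => |a i|⁻¹)
    (z : ℂ) : Multipliable fun i => 1 - z / a i := by
  simp_rw [sub_eq_add_neg]
  refine multipliable_one_add_of_summable ((ha.mul_left ‖z‖).congr fun i => ?_)
  rw [norm_neg, norm_div, norm_real, Real.norm_eq_abs, div_eq_mul_inv]

theorem multipliable_and_eq_mul_tprod (hf : Differentiable ℂ f) (h0 : f 0 ≠ 0)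
    (hsimple : ∀ w, f w = 0 → deriv f w ≠ 0) (hreal : ∀ w, f w = 0 → w.im = 0)
    (hρ0 : 0 < ρ) (hρ1 : ρ < 1) (hfm : ∀ z, ‖f z‖ ≤ ‖f 0‖ * Real.exp (B + τ * ‖z‖ ^ ρ))
    (hν : IsAscendingEnumeration {b : ℝ | f b = 0} ν) (z : ℂ) :
    Multipliable (fun n => 1 - z / ν n) ∧ f z = f 0 * ∏' n, (1 - z / ν n) := by
  have hmul := multipliable_one_sub_div_ofReal (summable_inv_zeros hf h0 hρ0 hρ1 hfm hν) z
  refine ⟨hmul, eq_mul_tprod_of_range_eq_zeros hf h0 hsimple (isLittleO_const_add_mul_rpow hρ1) hfm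
    (a := fun n => (ν n : ℂ)) (ofReal_injective.comp hν.strictMono.injective) ?_ hmul⟩
  refine Set.Subset.antisymm (Set.range_subset_iff.2 hν.mem) fun w hw => ?_
  have hw_re : (w.re : ℂ) = w := Complex.ext rfl (hreal w hw).symm
  obtain ⟨n, hn⟩ : w.re ∈ Set.range ν := by
    rw [hν.range_eq]
    exact hw_re.symm ▸ hw
  exact ⟨n, (congrArg ofReal hn).trans hw_re⟩

end Hadamard

section Growth

open Filter Topology Asymptotics

variable {q : ℝ → ℝ} {l κ : ℝ} {θ : ℂ}

theorem zeta_re_mem_Icc (k : Fin 3) : (zeta k).re ∈ Set.Icc (-(1 / 2) : ℝ) 1 := by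
  fin_cases k <;> simp [zeta] <;> norm_num

theorem zeta_re_of_ne_zero {k : Fin 3} (hk : k ≠ 0) : (zeta k).re = -(1 / 2) := by
  fin_cases k
  · exact absurd rfl hk
  all_goals simp [zeta]; norm_num

theorem abs_zeta_im_le (k : Fin 3) : |(zeta k).im| ≤ √3 / 2 := by
  have h0 : 0 ≤ √3 / 2 := by positivity
  fin_cases k <;> simp [zeta, abs_div, abs_of_nonneg (Real.sqrt_nonneg 3), h0]

theorem norm_specEnd_cube_le (hl : 0 ≤ l) (hq : IntervalIntegrable q volume 0 l) {lam : ℂ} {τ : ℝ}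
    (hlam : 1 ≤ ‖lam‖) (hτ : ∀ k, (I * lam * zeta k).re ≤ τ) :
    ‖specEnd q l (lam ^ 3)‖ ≤ Real.exp (∫ t in (0 : ℝ)..l, |q t|) * Real.exp (τ * l) := by
  have hfree : ∀ t ∈ Set.Icc 0 l, ‖freeSol 2 lam t‖ ≤ 1 * Real.exp (τ * t) := fun t ht =>
    (norm_freeSol_le_of_re_le 2 (norm_pos_iff.1 (one_pos.trans_le hlam)) ht.1 hτ).trans <| by
      gcongr
      exact inv_le_one_of_one_le₀ (one_le_pow₀ hlam)
  have hl' : l ∈ Set.Icc 0 l := ⟨hl, le_rfl⟩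
  rw [specEnd, ← fundSol_eq_specSol hq 2 lam hl']
  simpa using norm_fundSol_le hq hfree hfree hl'

theorem norm_specEnd_ofReal_cube_le (hl : 0 ≤ l) (hq : IntervalIntegrable q volume 0 l) {r : ℝ}
    (hr : 1 ≤ |r|) : ‖specEnd q l ((r : ℂ) ^ 3)‖
      ≤ Real.exp (∫ t in (0 : ℝ)..l, |q t|) * Real.exp (√3 / 2 * |r| * l) := by
  refine norm_specEnd_cube_le hl hq (by simpa using hr) fun k => ?_
  calc (I * (r : ℂ) * zeta k).re = -(r * (zeta k).im) := by simp [mul_re, mul_im]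
    _ ≤ |(zeta k).im| * |r| := by rw [← abs_mul, mul_comm]; exact neg_le_abs _
    _ ≤ √3 / 2 * |r| := by gcongr; exact abs_zeta_im_le k

theorem norm_specEnd_conj_I_mul_cube_le (hl : 0 ≤ l) (hq : IntervalIntegrable q volume 0 l)
    (hκ : 1 ≤ κ) : ‖specEnd q l ((starRingEnd ℂ) (I * (κ : ℂ) ^ 3))‖
      ≤ Real.exp (∫ t in (0 : ℝ)..l, |q t|) * Real.exp (√3 / 2 * κ * l) := by
  have hconj : (starRingEnd ℂ) (I * (κ : ℂ) ^ 3) = (I * κ) ^ 3 := by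
    rw [map_mul, map_pow, conj_I, conj_ofReal, mul_pow, I_pow_three]
  rw [hconj]
  have hκ0 : 0 ≤ κ := zero_le_one.trans hκ
  refine norm_specEnd_cube_le hl hq (by simpa [abs_of_nonneg hκ0] using hκ) fun k => ?_
  calc (I * (I * (κ : ℂ)) * zeta k).re = κ * -(zeta k).re := by
        rw [← mul_assoc, I_mul_I]; simp
    _ ≤ κ * (√3 / 2) := by
      gcongr
      have hsqrt : 1 ≤ √3 := Real.one_le_sqrt.2 (by norm_num)
      linarith [(zeta_re_mem_Icc k).1]
    _ = √3 / 2 * κ := mul_comm _ _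

theorem le_norm_freeSol_two_neg_I_mul (hκ : 0 < κ) {x : ℝ} (hx : 0 ≤ x) :
    (Real.exp (κ * x) - 2) / (3 * κ ^ 2) ≤ ‖freeSol 2 (-I * κ) x‖ := by
  have hκ0 : (κ : ℂ) ≠ 0 := ofReal_ne_zero.2 hκ.ne'
  have hI : I * (-I * κ) = κ := by rw [← mul_assoc, mul_neg, I_mul_I, neg_neg, one_mul]
  set c : Fin 3 → ℂ := fun k => exp (κ * zeta k * x) / (κ * zeta k) ^ 2
  have hnorm : ∀ k, ‖c k‖ = Real.exp (κ * (zeta k).re * x) / κ ^ 2 := fun k => by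
    simp [c, norm_exp, norm_zeta]
  have hdecay : ∀ k, k ≠ 0 → ‖c k‖ ≤ 1 / κ ^ 2 := fun k hk => by
    rw [hnorm, zeta_re_of_ne_zero hk]
    gcongr
    rw [Real.exp_le_one_iff]
    nlinarith [mul_nonneg hκ.le hx]
  have hfree : freeSol 2 (-I * κ) x = 1 / 3 * (c 0 + (c 1 + c 2)) := by
    rw [freeSol_of_ne_zero 2 (mul_ne_zero (neg_ne_zero.2 I_ne_zero) hκ0), hI, Fin.sum_univ_three,
      add_assoc]
    rfl
  have hc0 : ‖c 0‖ = Real.exp (κ * x) / κ ^ 2 := by simp [hnorm, zeta]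
  calc (Real.exp (κ * x) - 2) / (3 * κ ^ 2)
      = 1 / 3 * (‖c 0‖ - (1 / κ ^ 2 + 1 / κ ^ 2)) := by rw [hc0]; field_simp; ring
    _ ≤ 1 / 3 * (‖c 0‖ - ‖c 1 + c 2‖) := by
      gcongr
      exact norm_add_le_of_le (hdecay 1 (by decide)) (hdecay 2 (by decide))
    _ ≤ 1 / 3 * ‖c 0 + (c 1 + c 2)‖ := by
      gcongr
      exact norm_sub_le_norm_add _ _
    _ = ‖freeSol 2 (-I * κ) x‖ := by rw [hfree, norm_mul]; norm_num

theorem norm_specEnd_I_mul_cube_sub_freeSol_le (hl : 0 ≤ l)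
    (hq : IntervalIntegrable q volume 0 l) (hκ : 0 < κ) :
    ‖specEnd q l (I * (κ : ℂ) ^ 3) - freeSol 2 (-I * κ) l‖
      ≤ (κ ^ 2)⁻¹ * (∫ t in (0 : ℝ)..l, |q t|) * Real.exp ((κ ^ 2)⁻¹ * ∫ t in (0 : ℝ)..l, |q t|)
        * (Real.exp (κ * l) / κ ^ 2) := by
  have hI : I * (-I * κ) = κ := by rw [← mul_assoc, mul_neg, I_mul_I, neg_neg, one_mul]
  have hcube : (-I * (κ : ℂ)) ^ 3 = I * (κ : ℂ) ^ 3 := by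
    rw [mul_pow, Odd.neg_pow (by decide), I_pow_three, neg_neg]
  have hfree : ∀ t ∈ Set.Icc 0 l, ‖freeSol 2 (-I * κ) t‖ ≤ (κ ^ 2)⁻¹ * Real.exp (κ * t) := by
    intro t ht
    have hre : ∀ k, (I * (-I * (κ : ℂ)) * zeta k).re ≤ κ := fun k => by
      rw [hI, re_ofReal_mul]
      exact mul_le_of_le_one_right hκ.le (zeta_re_mem_Icc k).2
    simpa [abs_of_pos hκ] using norm_freeSol_le_of_re_le 2
      (mul_ne_zero (neg_ne_zero.2 I_ne_zero) (ofReal_ne_zero.2 hκ.ne')) ht.1 hre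
  rw [specEnd, ← hcube, ← fundSol_eq_specSol hq 2 _ ⟨hl, le_rfl⟩]
  refine (norm_fundSol_sub_freeSol_le hl hq hfree hfree).trans_eq ?_
  ring

theorem eventually_le_norm_specEnd_I_mul_cube (hl : 0 < l) (hq : IntervalIntegrable q volume 0 l) :
    ∀ᶠ κ : ℝ in atTop,
      Real.exp (κ * l) / (6 * κ ^ 2) ≤ ‖specEnd q l (I * (κ : ℂ) ^ 3)‖ := by
  set Q := ∫ t in (0 : ℝ)..l, |q t|
  have hsmall : ∀ᶠ κ : ℝ in atTop, (κ ^ 2)⁻¹ * Q * Real.exp ((κ ^ 2)⁻¹ * Q) ≤ 1 / 12 := by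
    have hlim : Tendsto (fun κ : ℝ => (κ ^ 2)⁻¹ * Q) atTop (𝓝 0) := by
      simpa using (tendsto_pow_atTop (α := ℝ) two_ne_zero).inv_tendsto_atTop.mul_const Q
    have hlim' := hlim.mul hlim.rexp
    rw [zero_mul] at hlim'
    exact hlim'.eventually_le_const (by norm_num)
  have hlarge : ∀ᶠ κ : ℝ in atTop, 8 ≤ Real.exp (κ * l) :=
    (Real.tendsto_exp_atTop.comp (tendsto_id.atTop_mul_const hl)).eventually_ge_atTop 8
  filter_upwards [hsmall, hlarge, eventually_gt_atTop 0] with κ hsmall hlarge hκ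
  have hfree := le_norm_freeSol_two_neg_I_mul hκ hl.le
  have hdiff := (norm_specEnd_I_mul_cube_sub_freeSol_le hl.le hq hκ).trans
    (mul_le_mul_of_nonneg_right hsmall (by positivity))
  have htriangle := norm_sub_norm_le (freeSol 2 (-I * κ) l) (specEnd q l (I * (κ : ℂ) ^ 3))
  rw [norm_sub_rev] at htriangle
  calc Real.exp (κ * l) / (6 * κ ^ 2)
      ≤ (Real.exp (κ * l) - 2) / (3 * κ ^ 2) - 1 / 12 * (Real.exp (κ * l) / κ ^ 2) := by
        rw [← sub_nonneg]
        have hrw : (Real.exp (κ * l) - 2) / (3 * κ ^ 2) - 1 / 12 * (Real.exp (κ * l) / κ ^ 2)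
            - Real.exp (κ * l) / (6 * κ ^ 2) = (Real.exp (κ * l) - 8) / (12 * κ ^ 2) := by
          field_simp
          ring
        rw [hrw]
        exact div_nonneg (by linarith) (by positivity)
    _ ≤ ‖specEnd q l (I * (κ : ℂ) ^ 3)‖ := by linarith

theorem norm_specFun_le (hθ : ‖θ‖ = 1) (z : ℂ) :
    ‖specFun q l θ z‖ ≤ ‖specEnd q l ((starRingEnd ℂ) z)‖ + ‖specEnd q l z‖ := by
  rw [specFun, norm_neg]
  exact (norm_add_le _ _).trans_eq (by rw [RCLike.norm_conj, norm_mul, hθ, one_mul])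

theorem norm_specEnd_sub_le_norm_specFun (hθ : ‖θ‖ = 1) (z : ℂ) :
    ‖specEnd q l z‖ - ‖specEnd q l ((starRingEnd ℂ) z)‖ ≤ ‖specFun q l θ z‖ := by
  rw [specFun, norm_neg, add_comm]
  refine (norm_sub_le_norm_add _ _).trans' (le_of_eq ?_)
  rw [RCLike.norm_conj, norm_mul, hθ, one_mul]

theorem eventually_const_mul_exp_lt (D : ℝ) {α β : ℝ} (hαβ : α < β) :
    ∀ᶠ κ : ℝ in atTop, D * Real.exp (α * κ) < Real.exp (β * κ) / (6 * κ ^ 2) := by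
  have hlim : Tendsto (fun κ : ℝ => 6 * D * (κ ^ 2 / Real.exp ((β - α) * κ))) atTop (𝓝 0) := by
    simpa using
      (isLittleO_pow_exp_pos_mul_atTop 2 (sub_pos.2 hαβ)).tendsto_div_nhds_zero.const_mul (6 * D)
  filter_upwards [hlim.eventually_lt_const one_pos, eventually_gt_atTop 0] with κ hlt hκ
  rw [← mul_div_assoc, div_lt_one (Real.exp_pos _), sub_mul, Real.exp_sub,
    lt_div_iff₀ (Real.exp_pos _)] at hlt
  rw [lt_div_iff₀ (by positivity)]
  linarith

theorem eventually_mul_norm_specFun_real_lt (hl : 0 < l) (hq : IntervalIntegrable q volume 0 l)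
    (hθ : ‖θ‖ = 1) {σ : ℝ} (hσ : |σ| = 1) (K : ℝ) :
    ∀ᶠ κ : ℝ in atTop,
      K * ‖specFun q l θ ((σ * κ : ℝ) ^ 3)‖ < ‖specFun q l θ (I * (κ : ℂ) ^ 3)‖ := by
  set Q := Real.exp (∫ t in (0 : ℝ)..l, |q t|)
  have hrate : √3 / 2 * l < l := by
    have hsqrt : √3 < 2 := (Real.sqrt_lt' two_pos).2 (by norm_num)
    nlinarith
  filter_upwards [eventually_const_mul_exp_lt ((2 * |K| + 1) * Q) hrate,
    eventually_le_norm_specEnd_I_mul_cube hl hq, eventually_ge_atTop 1] with κ hexp hlower hκ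
  rw [mul_right_comm (√3 / 2), mul_comm l κ] at hexp
  have habs : |σ * κ| = κ := by rw [abs_mul, hσ, one_mul, abs_of_nonneg (zero_le_one.trans hκ)]
  have hreal : ‖specFun q l θ ((σ * κ : ℝ) ^ 3)‖ ≤ 2 * (Q * Real.exp (√3 / 2 * κ * l)) := by
    have hend := norm_specEnd_ofReal_cube_le hl.le hq (hκ.trans_eq habs.symm)
    have hfun := norm_specFun_le (q := q) (l := l) hθ ((σ * κ : ℝ) ^ 3)
    rw [map_pow, conj_ofReal] at hfun
    rw [habs] at hend
    linarith
  have himag := norm_specEnd_sub_le_norm_specFun (q := q) (l := l) hθ (I * (κ : ℂ) ^ 3)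
  have hconj := norm_specEnd_conj_I_mul_cube_le hl.le hq hκ
  have hK : K * ‖specFun q l θ ((σ * κ : ℝ) ^ 3)‖ ≤ |K| * (2 * (Q * Real.exp (√3 / 2 * κ * l))) :=
    mul_le_mul (le_abs_self K) hreal (norm_nonneg _) (abs_nonneg K)
  linarith

theorem frequently_mul_norm_specFun_real_lt (hl : 0 < l) (hq : IntervalIntegrable q volume 0 l)
    (hθ : ‖θ‖ = 1) {σ : ℝ} (hσ : |σ| = 1) (K : ℝ) :
    ∃ᶠ y : ℝ in atTop, K * ‖specFun q l θ (σ * y : ℝ)‖ < ‖specFun q l θ (I * y)‖ := by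
  have hσ3 : σ ^ 3 = σ := by rw [pow_succ, ← sq_abs, hσ, one_pow, one_mul]
  refine (tendsto_pow_atTop three_ne_zero).frequently (p := fun y : ℝ =>
    K * ‖specFun q l θ (σ * y : ℝ)‖ < ‖specFun q l θ (I * y)‖) (Eventually.frequently ?_)
  filter_upwards [eventually_mul_norm_specFun_real_lt hl hq hθ hσ K] with κ hκ
  rwa [← ofReal_pow, ← ofReal_pow, mul_pow, hσ3] at hκ

theorem exists_norm_specFun_le_mul_exp (hl : 0 ≤ l) (hq : IntervalIntegrable q volume 0 l)
    (hθ : ‖θ‖ = 1) (h0 : specFun q l θ 0 ≠ 0) : ∃ B : ℝ, ∀ z,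
      ‖specFun q l θ z‖ ≤ ‖specFun q l θ 0‖ * Real.exp (B + l * ‖z‖ ^ (1 / 3 : ℝ)) := by
  set A : ℝ := 2 * ((1 + l) ^ 2 * Real.exp ((1 + l) ^ 2 * ∫ t in (0 : ℝ)..l, |q t|)) with hA
  have h0' : 0 < ‖specFun q l θ 0‖ := norm_pos_iff.2 h0
  refine ⟨Real.log (A / ‖specFun q l θ 0‖), fun z => ?_⟩
  have hend : ∀ w, ‖specEnd q l w‖ ≤ (1 + l) ^ 2
      * Real.exp ((1 + l) ^ 2 * ∫ t in (0 : ℝ)..l, |q t|)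
      * Real.exp (‖w‖ ^ (1 / 3 : ℝ) * l) := fun w => norm_specSol_le hq 2 w ⟨hl, le_rfl⟩
  have hconj := hend ((starRingEnd ℂ) z)
  rw [RCLike.norm_conj] at hconj
  have hA0 : 0 < A / ‖specFun q l θ 0‖ := by positivity
  rw [Real.exp_add, Real.exp_log hA0, ← mul_assoc, mul_div_cancel₀ _ h0'.ne', mul_comm l, hA]
  linarith [norm_specFun_le (q := q) (l := l) hθ z, hend z]

end Growth

section CharacteristicFunction

open Filter

variable {q : ℝ → ℝ} {l : ℝ} {θ : ℂ}

/-- The cube as an order automorphism of `ℝ`; it carries the real zeros in the spectral parameter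
`λ` to the real zeros in `z = λ³`. -/
def cubeOrderIso : ℝ ≃o ℝ :=
  (Odd.strictMono_pow (by decide : Odd 3)).orderIsoOfSurjective _ <|
    (continuous_pow 3).surjective (tendsto_pow_atTop three_ne_zero) <|
      (tendsto_neg_atTop_atBot.comp <|
        (tendsto_pow_atTop three_ne_zero).comp tendsto_neg_atBot_atTop).congr fun x => by
          simp only [Function.comp_apply, Odd.neg_pow (by decide : Odd 3), neg_neg]

theorem cubeOrderIso_symm_pow (b : ℝ) : cubeOrderIso.symm b ^ 3 = b :=
  cubeOrderIso.apply_symm_apply b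

theorem realZeros_eq_image (hl : 0 < l) (hq : IntervalIntegrable q volume 0 l) (θ : ℂ) :
    realZeros q l θ = cubeOrderIso.symm '' {b : ℝ | specFun q l θ b = 0} := by
  rw [OrderIso.image_eq_preimage_symm]
  ext x
  rw [realZeros, Set.mem_ofPred_eq, charFun_eq_specFun hl hq, ← ofReal_pow]
  rfl

theorem aConst_eq_specEnd (hl : 0 ≤ l) (hq : IntervalIntegrable q volume 0 l) :
    aConst q l = specEnd q l 0 := by
  rw [aConst, fundSol_eq_specSol hq 2 0 ⟨hl, le_rfl⟩, zero_pow three_ne_zero, specEnd]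

theorem aConst_ne_zero (hl : 0 < l) (hq : IntervalIntegrable q volume 0 l) : aConst q l ≠ 0 := by
  rw [aConst_eq_specEnd hl.le hq]
  exact specEnd_ne_zero_of_im_nonneg hl hq le_rfl

theorem specFun_zero (hl : 0 < l) (hq : IntervalIntegrable q volume 0 l) (θ : ℂ) :
    specFun q l θ 0 = -aConst q l * (θ + theta0 q l) := by
  have ha := aConst_ne_zero hl hq
  rw [specFun, map_zero, ← aConst_eq_specEnd hl.le hq, theta0]
  field_simp
  ring

theorem norm_theta0 (ha : aConst q l ≠ 0) : ‖theta0 q l‖ = 1 := by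
  rw [theta0, norm_div, RCLike.norm_conj, div_self (norm_ne_zero_iff.2 ha)]

theorem exists_isAscendingEnumeration_charFun_eq (hl : 0 < l)
    (hq : IntervalIntegrable q volume 0 l) (hθ : ‖θ‖ = 1) (h0 : specFun q l θ 0 ≠ 0) :
    ∃ μ : ℤ → ℝ, IsAscendingEnumeration (realZeros q l θ) μ ∧ ∀ lam : ℂ,
      Multipliable (fun n : ℤ => 1 - lam ^ 3 / (μ n : ℂ) ^ 3) ∧
        charFun q l θ lam = specFun q l θ 0 * ∏' n : ℤ, (1 - lam ^ 3 / (μ n : ℂ) ^ 3) := by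
  have hf := differentiable_specFun hl.le hq θ
  have hsimple : ∀ w, specFun q l θ w = 0 → deriv (specFun q l θ) w ≠ 0 := fun _ =>
    deriv_specFun_ne_zero hl hq hθ
  have hreal : ∀ w, specFun q l θ w = 0 → w.im = 0 := fun _ =>
    im_eq_zero_of_specFun_eq_zero hl hq hθ
  obtain ⟨B, hB⟩ := exists_norm_specFun_le_mul_exp hl.le hq hθ h0
  have horder : (1 / 3 : ℝ) < 1 := by norm_num
  obtain ⟨ν, hν⟩ := exists_isAscendingEnumeration_zeros hf h0 hsimple hreal
    (isLittleO_const_add_mul_rpow horder) hB fun σ hσ =>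
      frequently_mul_norm_specFun_real_lt hl hq hθ hσ
  refine ⟨cubeOrderIso.symm ∘ ν, ?_, fun lam => ?_⟩
  · rw [realZeros_eq_image hl hq]
    exact hν.image_orderIso (cubeOrderIso.symm_apply_eq.2 (zero_pow three_ne_zero).symm)
  · rw [charFun_eq_specFun hl hq]
    simp_rw [Function.comp_apply, ← ofReal_pow, cubeOrderIso_symm_pow]
    exact multipliable_and_eq_mul_tprod hf h0 hsimple hreal (by norm_num) horder hB hν (lam ^ 3)

end CharacteristicFunction

end ThirdOrder

end

theorem lemma2p6_general (l : ℝ) (hl : 0 < l) (q : ℝ → ℝ)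
    (hq : IntervalIntegrable q MeasureTheory.volume 0 l) :
    ThirdOrder.aConst q l ≠ 0 ∧ ‖ThirdOrder.theta0 q l‖ = 1 ∧
    ∀ θ : ℂ, ‖θ‖ = 1 → θ + ThirdOrder.theta0 q l ≠ 0 →
      ∃ μ : ℤ → ℝ,
        ThirdOrder.IsAscendingEnumeration (ThirdOrder.realZeros q l θ) μ ∧
        ∀ lam : ℂ,
          Multipliable (fun n : ℤ => 1 - lam ^ 3 / (μ n : ℂ) ^ 3) ∧
          ThirdOrder.charFun q l θ lam =
            -ThirdOrder.aConst q l * (θ + ThirdOrder.theta0 q l) *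
              ∏' n : ℤ, (1 - lam ^ 3 / (μ n : ℂ) ^ 3) := by
  have ha := ThirdOrder.aConst_ne_zero hl hq
  refine ⟨ha, ThirdOrder.norm_theta0 ha, fun θ hθ hne => ?_⟩
  rw [← ThirdOrder.specFun_zero hl hq θ]
  refine ThirdOrder.exists_isAscendingEnumeration_charFun_eq hl hq hθ ?_
  rw [ThirdOrder.specFun_zero hl hq θ]
  exact mul_ne_zero (neg_ne_zero.2 ha) hne

theorem lemma2p6 (l : ℝ) (hl : 0 < l) (q : ℝ → ℝ)
    (hq : MeasureTheory.MemLp q 2 (MeasureTheory.volume.restrict (Set.Ioo 0 l))) :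
    ThirdOrder.aConst q l ≠ 0 ∧ ‖ThirdOrder.theta0 q l‖ = 1 ∧
    ∀ θ : ℂ, ‖θ‖ = 1 → θ + ThirdOrder.theta0 q l ≠ 0 →
      ∃ μ : ℤ → ℝ,
        ThirdOrder.IsAscendingEnumeration (ThirdOrder.realZeros q l θ) μ ∧
        ∀ lam : ℂ,
          Multipliable (fun n : ℤ => 1 - lam ^ 3 / (μ n : ℂ) ^ 3) ∧
          ThirdOrder.charFun q l θ lam =
            -ThirdOrder.aConst q l * (θ + ThirdOrder.theta0 q l) *
              ∏' n : ℤ, (1 - lam ^ 3 / (μ n : ℂ) ^ 3) :=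
  lemma2p6_general l hl q <| (intervalIntegrable_iff_integrableOn_Ioo_of_le hl.le).2
    (hq.integrable one_le_two)
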